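/- \textbf{Setting.} Let $G$ be a locally compact (Hausdorff) abelian group, written multiplicatively, with Haar measure $dg$ and dual group $\hat G$. Let $A$ be a C*-algebra and let $\alpha\colon G\to \mathrm{Aut}(A)$ be a group homomorphism; no continuity of $\alpha$ is assumed. Let $C^*(G)$ be the full group C*-algebra and $\eta\colon G\to UM(C^*(G))$ the canonical homomorphism into the unitary multipliers. For $f\in L^1(G)$ write $f$ also for its image in $C^*(G)$. Let $B=\mathrm{fcph}(A,G,\alpha)$ be a full crossed product host for $(\alpha,C^*(G))$. That is, $B$ is a C*-algebra with $*$-homomorphisms $\eta_A\colon A\to M(B)$ and $\eta_L\colon C^*(G)\to M(B)$ such that: (a) the linear span of $\eta_L(C^*(G))B$ is dense in $B$, so that $\eta_L$ extends to a unital $*$-homomorphism $\widetilde\eta_L\colon M(C^*(G))\to M(B)$; (b) with $\lambda_g:=\widetilde\eta_L(\eta(g))$, one has $\lambda_g\eta_A(a)\lambda_g^*=\eta_A(\alpha_g(a))$ for all $a\in A$, $g\in G$; (c) $\eta_A(A)\eta_L(C^*(G))\subseteq B$, and this set generates $B$ as a C*-algebra; (d) for every covariant representation $(\pi,U)$ of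 $(A,G,\alpha)$ on a Hilbert space $H$ ($\pi$ nondegenerate, $U$ unitary and strongly continuous) there is a unique representation $\rho\colon B\to B(H)$ with $\rho(\eta_A(a)\eta_L(l))=\pi(a)U(l)$ for all $a\in A$, $l\in C^*(G)$, where $U(\cdot)$ also denotes the representation of $C^*(G)$ corresponding to $U$. A \emph{$G$-product structure} on $B$ consists of a homomorphism $\lambda\colon G\to UM(B)$ such that $g\mapsto\lambda_g y$ is continuous for every $y\in B$, and a homomorphism $\hat\alpha\colon\hat G\to\mathrm{Aut}(B)$ such that $\tau\mapsto\hat\alpha_\tau(y)$ is continuous for every $y\in B$ and $\hat\alpha_\tau(\lambda_g)=\langle g,\tau\rangle\lambda_g$ for all $g\in G$, $\tau\in\hat G$ (with $\hat\alpha_\tau$ extended to $M(B)$). Then $\lambda_f:=\int_G f(g)\lambda_g\,dg\in M(B)$ is defined for $f\in L^1(G)$ as a strictly convergent integral. For $x\in M(B)$ consider the conditions: (L1) $\hat\alpha_\tau(x)=x$ for all $\tau\in\hat G$; (L2) $x\lambda_f\in B$ and $\lambda_f x\in B$ for all $f\in L^1(G)$; (L3) $g\mapsto\lambda_g x\lambda_{g^{-1}}$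 is norm continuous on $G$; (L3') $g\mapsto\lambda_g x\lambda_{g^{-1}}$ is strictly continuous on $G$. \textbf{Proposition.} There is exactly one $G$-product structure on $B$ with $\lambda_g=\widetilde\eta_L(\eta(g))$ for all $g\in G$ and $\hat\alpha_\tau(\eta_A(a)\eta_L(f))=\eta_A(a)\eta_L(\tau f)$ for all $\tau\in\hat G$, $a\in A$, $f\in L^1(G)$, where $(\tau f)(g)=\langle g,\tau\rangle f(g)$. With respect to this structure, let $A^\#$ (the Landstad algebra) be the set of all $x\in M(B)$ satisfying (L1), (L2), (L3), and let $A^b$ (the weak Landstad algebra) be the set of all $x\in M(B)$ satisfying (L1), (L2), (L3'). Then $$A^\#\subseteq A^b\qquad\text{and}\qquad \eta_A(A)\subseteq A^b .$$ -/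

import Mathlib

open MeasureTheory Filter Topology
open scoped ENNReal MultiplierAlgebra

universe u

noncomputable section

namespace CPHost

/-! ## Integration against an `L¹`-function on a locally compact group -/

section Smearing

variable {G : Type*} [Group G] [TopologicalSpace G] [IsTopologicalGroup G] [T2Space G]
  [LocallyCompactSpace G] [MeasurableSpace G] [BorelSpace G]
variable {E : Type*} [NormedAddCommGroup E] [NormedSpace ℂ E]

theorem integrable_smul {f : G → ℂ} (hf : Integrable f (Measure.haar (G := G))) {F : G → E}
    (hF : Continuous F) {c : ℝ} (hc : ∀ g, ‖F g‖ ≤ c) :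
    Integrable (fun g => f g • F g) (Measure.haar (G := G)) := by
  have key : AEStronglyMeasurable (fun g => f g • F g) (Measure.haar (G := G)) := by
    set μ := Measure.haar (G := G)
    obtain ⟨k, hk, hfk⟩ := hf.1
    have hki : Integrable k μ := hf.congr hfk
    set A : ℕ → Set G := fun n => {g | 1 / ((n : ℝ) + 1) ≤ ‖k g‖} with hA
    have hAm : ∀ n, MeasurableSet (A n) := fun n =>
      measurableSet_le measurable_const hk.norm.measurable
    have hAf : ∀ n, μ (A n) ≠ ∞ := fun n =>
      (hki.measure_norm_ge_lt_top (by positivity)).ne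
    have hex : ∀ n m : ℕ, ∃ K ⊆ A n, IsCompact K ∧ μ (A n \ K) < ENNReal.ofReal (1 / (m + 1)) :=
      fun n m => (hAm n).exists_isCompact_sdiff_lt (hAf n)
        (by simpa using (by positivity : (0 : ℝ) < (m : ℝ) + 1))
    choose K hKA hK hKμ using hex
    set S : Set G := ⋃ p : ℕ × ℕ, K p.1 p.2 with hS
    have hSm : MeasurableSet S := MeasurableSet.iUnion fun p => (hK p.1 p.2).isClosed.measurableSet
    have hFS : AEStronglyMeasurable F (μ.restrict S) :=
      aestronglyMeasurable_iUnion_iff.2 fun p =>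
        hF.continuousOn.aestronglyMeasurable_of_isCompact (hK p.1 p.2)
          (hK p.1 p.2).isClosed.measurableSet
    have hdiff : ∀ n, μ (A n \ S) = 0 := fun n => by
      have h1 : Tendsto (fun m : ℕ => ENNReal.ofReal (1 / ((m : ℝ) + 1))) atTop (𝓝 0) := by
        simpa using ENNReal.tendsto_ofReal tendsto_one_div_add_atTop_nhds_zero_nat
      refine le_antisymm (ge_of_tendsto' h1 fun m => ?_) zero_le
      refine (measure_mono ?_).trans (hKμ n m).le
      exact Set.sdiff_subset_sdiff_right (Set.subset_iUnion (fun p : ℕ × ℕ => K p.1 p.2) (n, m))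
    have hz : ∀ᵐ g ∂μ, g ∉ S → k g = 0 := by
      have h2 : μ (⋃ n, A n \ S) = 0 := measure_iUnion_null hdiff
      filter_upwards [compl_mem_ae_iff.2 h2] with g hg hgS
      by_contra hne
      obtain ⟨n, hn⟩ := exists_nat_one_div_lt (norm_pos_iff.2 hne)
      exact hg (Set.mem_iUnion.2 ⟨n, hn.le, hgS⟩)
    have hfS : AEStronglyMeasurable (fun g => k g • F g) (μ.restrict S) :=
      hk.aestronglyMeasurable.smul hFS
    refine ((aestronglyMeasurable_indicator_iff hSm).2 hfS).congr ?_
    filter_upwards [hfk, hz] with g hg hg'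
    by_cases hgS : g ∈ S
    · simp [hgS, hg]
    · simp [hgS, hg, hg' hgS]
  refine (hf.norm.mul_const c).mono' key (Eventually.of_forall fun g => ?_)
  rw [norm_smul]
  exact mul_le_mul_of_nonneg_left (hc g) (norm_nonneg _)

/-- The operator `v ↦ ∫ f(g) T_g v dg` for a strongly continuous family `T` of contractions and an
integrable function `f`. -/
def smear (T : G → E →L[ℂ] E) (hT : ∀ v, Continuous fun g => T g v)
    (hb : ∀ g v, ‖T g v‖ ≤ ‖v‖) (f : G → ℂ) (hf : Integrable f (Measure.haar (G := G))) :
    E →L[ℂ] E :=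
  LinearMap.mkContinuous
    { toFun := fun v => ∫ g, f g • T g v ∂(Measure.haar (G := G))
      map_add' := fun v w => by
        simp only [map_add, smul_add]
        exact integral_add (integrable_smul hf (hT v) fun g => hb g v)
          (integrable_smul hf (hT w) fun g => hb g w)
      map_smul' := fun c v => by
        simp only [map_smul, RingHom.id_apply, smul_comm _ c]
        exact integral_smul c _ }
    (∫ g, ‖f g‖ ∂(Measure.haar (G := G)))
    (fun v => by
      change ‖∫ g, f g • T g v ∂(Measure.haar (G := G))‖ ≤ _
      rw [← integral_mul_const]
      refine norm_integral_le_of_norm_le (hf.norm.mul_const _) (Eventually.of_forall fun g => ?_)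
      rw [norm_smul]
      exact mul_le_mul_of_nonneg_left (hb g v) (norm_nonneg _))

theorem smear_apply (T : G → E →L[ℂ] E) (hT : ∀ v, Continuous fun g => T g v)
    (hb : ∀ g v, ‖T g v‖ ≤ ‖v‖) (f : G → ℂ) (hf : Integrable f (Measure.haar (G := G))) (v : E) :
    smear T hT hb f hf v = ∫ g, f g • T g v ∂(Measure.haar (G := G)) := rfl

theorem norm_smear_le (T : G → E →L[ℂ] E) (hT : ∀ v, Continuous fun g => T g v)
    (hb : ∀ g v, ‖T g v‖ ≤ ‖v‖) (f : G → ℂ) (hf : Integrable f (Measure.haar (G := G))) :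
    ‖smear T hT hb f hf‖ ≤ ∫ g, ‖f g‖ ∂(Measure.haar (G := G)) :=
  LinearMap.mkContinuous_norm_le _ (integral_nonneg fun _ => norm_nonneg _) _

end Smearing

/-! ## The group C⋆-algebra -/

/-- A strongly continuous unitary representation of `G` on a complex Hilbert space. -/
structure UnitaryRep (G : Type u) [Group G] [TopologicalSpace G] : Type (u + 1) where
  space : Type u
  [instNormed : NormedAddCommGroup space]
  [instInner : InnerProductSpace ℂ space]
  [instComplete : CompleteSpace space]
  toHom : G →* unitary (space →L[ℂ] space)
  continuous_apply : ∀ v, Continuous fun g => (toHom g : space →L[ℂ] space) v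

attribute [instance] UnitaryRep.instNormed UnitaryRep.instInner UnitaryRep.instComplete

section Unitary

variable {E : Type*} [CStarAlgebra E]

theorem norm_unitary_le (U : unitary E) : ‖(U : E)‖ ≤ 1 := by
  rcases subsingleton_or_nontrivial E with h | h
  · rw [Subsingleton.elim (U : E) 0, norm_zero]; exact zero_le_one
  · exact (CStarRing.norm_coe_unitary U).le

end Unitary

section GroupAlgebra

/-- The product of the C⋆-algebras `B(H_U)`, over all strongly continuous unitary
representations `U` of `G`. -/
def RepProduct (G : Type u) [Group G] [TopologicalSpace G] : Type (u + 1) :=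
  lp (fun U : UnitaryRep G => U.space →L[ℂ] U.space) ∞

instance (G : Type u) [Group G] [TopologicalSpace G] : NonUnitalCStarAlgebra (RepProduct G) :=
  inferInstanceAs
    (NonUnitalCStarAlgebra (lp (fun U : UnitaryRep G => U.space →L[ℂ] U.space) ∞))

section Basic

variable {G : Type u} [Group G] [TopologicalSpace G]

/-- A bounded family of operators as an element of the product. -/
def RepProduct.mk (x : ∀ U : UnitaryRep G, U.space →L[ℂ] U.space) (c : ℝ)
    (hx : ∀ U, ‖x U‖ ≤ c) : RepProduct G :=
  ⟨x, memℓp_infty ⟨c, by rintro _ ⟨U, rfl⟩; exact hx U⟩⟩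

/-- The coordinate of an element of the product at the representation `U`. -/
def RepProduct.eval (U : UnitaryRep G) : RepProduct G →⋆ₙₐ[ℂ] (U.space →L[ℂ] U.space) where
  toFun x := x.1 U
  map_smul' _ _ := rfl
  map_zero' := rfl
  map_add' _ _ := rfl
  map_mul' _ _ := rfl
  map_star' _ := rfl

theorem RepProduct.eval_mk (x : ∀ U : UnitaryRep G, U.space →L[ℂ] U.space) (c : ℝ)
    (hx : ∀ U, ‖x U‖ ≤ c) (U : UnitaryRep G) : RepProduct.eval U (RepProduct.mk x c hx) = x U := rfl

theorem RepProduct.ext {x y : RepProduct G}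
    (h : ∀ U, RepProduct.eval U x = RepProduct.eval U y) : x = y :=
  Subtype.ext (funext h)

theorem UnitaryRep.norm_apply_le (U : UnitaryRep G) (g : G) (v : U.space) :
    ‖(U.toHom g : U.space →L[ℂ] U.space) v‖ ≤ ‖v‖ := by
  simpa using (U.toHom g : U.space →L[ℂ] U.space).le_of_opNorm_le (norm_unitary_le (U.toHom g)) v

/-- The family `(U_g)_U`. -/
def groupFamily (g : G) : RepProduct G :=
  RepProduct.mk (fun U => (U.toHom g : U.space →L[ℂ] U.space)) 1 fun _ => norm_unitary_le _

theorem groupFamily_mul (g h : G) : groupFamily (g * h) = groupFamily g * groupFamily h := by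
  refine RepProduct.ext fun U => ?_
  rw [map_mul]
  simp [groupFamily, RepProduct.eval_mk]

theorem groupFamily_one_mul (x : RepProduct G) : groupFamily 1 * x = x := by
  refine RepProduct.ext fun U => ?_
  rw [map_mul]
  simp [groupFamily, RepProduct.eval_mk]

theorem mul_groupFamily_one (x : RepProduct G) : x * groupFamily 1 = x := by
  refine RepProduct.ext fun U => ?_
  rw [map_mul]
  simp [groupFamily, RepProduct.eval_mk]

theorem star_groupFamily (g : G) : star (groupFamily g) = groupFamily g⁻¹ := by
  refine RepProduct.ext fun U => ?_
  rw [map_star]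
  simp [groupFamily, RepProduct.eval_mk, ← Unitary.star_eq_inv]

end Basic

variable {G : Type u} [CommGroup G] [TopologicalSpace G] [IsTopologicalGroup G] [T2Space G]
  [LocallyCompactSpace G] [MeasurableSpace G] [BorelSpace G]

/-- The integrated form `U(f) = ∫ f(g) U_g dg`. -/
def UnitaryRep.integrated (U : UnitaryRep G) (f : G → ℂ)
    (hf : Integrable f (Measure.haar (G := G))) : U.space →L[ℂ] U.space :=
  smear (fun g => (U.toHom g : U.space →L[ℂ] U.space)) U.continuous_apply U.norm_apply_le f hf

/-- The family `(U(f))_U`. -/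
def integratedFamily (f : G → ℂ) (hf : Integrable f (Measure.haar (G := G))) : RepProduct G :=
  RepProduct.mk (fun U => U.integrated f hf) (∫ g, ‖f g‖ ∂(Measure.haar (G := G)))
    fun _ => norm_smear_le _ _ _ _ _

variable (G) in
/-- The set of all the families `(U(f))_U`, `f ∈ L¹(G)`. -/
def integratedFamilies : Set (RepProduct G) :=
  {x | ∃ (f : G → ℂ) (hf : Integrable f (Measure.haar (G := G))), x = integratedFamily f hf}

variable (G) in
/-- The norm closure of the `⋆`-algebra of all the families `(U(f))_U`, `f ∈ L¹(G)`. -/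
def groupCStarSubalgebra : NonUnitalStarSubalgebra ℂ (RepProduct G) :=
  (NonUnitalStarAlgebra.adjoin ℂ (integratedFamilies G)).topologicalClosure

instance isClosed_groupCStarSubalgebra :
    IsClosed (groupCStarSubalgebra G : Set (RepProduct G)) :=
  NonUnitalStarSubalgebra.isClosed_topologicalClosure _

variable (G) in
/-- The (full) group C⋆-algebra `C⋆(G)`: the completion of (the image of) `L¹(G)` in the norm
`‖f‖ = sup_U ‖U(f)‖`, where `U` runs through all the strongly continuous unitary representations
of `G`. -/
def GroupCStar : Type (u + 1) := groupCStarSubalgebra G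

instance : NonUnitalCStarAlgebra (GroupCStar G) :=
  inferInstanceAs (NonUnitalCStarAlgebra (groupCStarSubalgebra G))

/-- The inclusion of `C⋆(G)` into the product of all the `B(H_U)`. -/
def GroupCStar.incl : GroupCStar G →⋆ₙₐ[ℂ] RepProduct G where
  toFun x := x.1
  map_smul' _ _ := rfl
  map_zero' := rfl
  map_add' _ _ := rfl
  map_mul' _ _ := rfl
  map_star' _ := rfl

theorem GroupCStar.ext {x y : GroupCStar G} (h : GroupCStar.incl x = GroupCStar.incl y) : x = y :=
  Subtype.ext h

theorem integratedFamily_mem (f : G → ℂ) (hf : Integrable f (Measure.haar (G := G))) :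
    integratedFamily f hf ∈ groupCStarSubalgebra G :=
  NonUnitalStarSubalgebra.le_topologicalClosure _
    (NonUnitalStarAlgebra.subset_adjoin ℂ _ ⟨f, hf, rfl⟩)

/-- The canonical image of an integrable function in `C⋆(G)`. -/
def ofL1 (f : G → ℂ) (hf : Integrable f (Measure.haar (G := G))) : GroupCStar G :=
  ⟨integratedFamily f hf, integratedFamily_mem f hf⟩

/-- The representation of `C⋆(G)` that corresponds to the unitary representation `U` of `G`. It is
the evaluation at the coordinate `U`. -/
def UnitaryRep.integratedRep (U : UnitaryRep G) :
    GroupCStar G →⋆ₙₐ[ℂ] (U.space →L[ℂ] U.space) :=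
  (RepProduct.eval U).comp GroupCStar.incl

theorem UnitaryRep.integratedRep_ofL1 (U : UnitaryRep G) (f : G → ℂ)
    (hf : Integrable f (Measure.haar (G := G))) :
    U.integratedRep (ofL1 f hf) = U.integrated f hf := rfl

theorem groupFamily_mul_integratedFamily (g : G) (f : G → ℂ)
    (hf : Integrable f (Measure.haar (G := G))) :
    groupFamily g * integratedFamily f hf =
      integratedFamily (fun h => f (g⁻¹ * h)) (hf.comp_mul_left g⁻¹) := by
  refine RepProduct.ext fun U => ContinuousLinearMap.ext fun v => ?_
  change (U.toHom g : U.space →L[ℂ] U.space) (∫ h, f h • (U.toHom h : U.space →L[ℂ] U.space) v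
    ∂(Measure.haar (G := G))) = ∫ h, f (g⁻¹ * h) • (U.toHom h : U.space →L[ℂ] U.space) v
    ∂(Measure.haar (G := G))
  rw [← ContinuousLinearMap.integral_comp_comm _
    (integrable_smul hf (U.continuous_apply v) fun g => U.norm_apply_le g v),
    ← integral_mul_left_eq_self
      (fun h => f (g⁻¹ * h) • (U.toHom h : U.space →L[ℂ] U.space) v) g]
  simp

theorem integratedFamily_mul_groupFamily (g : G) (f : G → ℂ)
    (hf : Integrable f (Measure.haar (G := G))) :
    integratedFamily f hf * groupFamily g = groupFamily g * integratedFamily f hf := by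
  refine RepProduct.ext fun U => ContinuousLinearMap.ext fun v => ?_
  change (∫ h, f h • (U.toHom h : U.space →L[ℂ] U.space) ((U.toHom g : U.space →L[ℂ] U.space) v)
    ∂(Measure.haar (G := G))) = (U.toHom g : U.space →L[ℂ] U.space)
    (∫ h, f h • (U.toHom h : U.space →L[ℂ] U.space) v ∂(Measure.haar (G := G)))
  rw [← ContinuousLinearMap.integral_comp_comm _
    (integrable_smul hf (U.continuous_apply v) fun g => U.norm_apply_le g v)]
  refine integral_congr_ae (Eventually.of_forall fun h => ?_)
  have hc : (U.toHom h : U.space →L[ℂ] U.space) * U.toHom g =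
      (U.toHom g : U.space →L[ℂ] U.space) * U.toHom h := by
    rw [← Submonoid.coe_mul, ← Submonoid.coe_mul, ← map_mul, ← map_mul, mul_comm]
  have hv := congrArg (fun T : U.space →L[ℂ] U.space => T v) hc
  simp only [map_smul]
  exact congrArg (f h • ·) hv

theorem groupFamily_mul_mem (g : G) {x : RepProduct G} (hx : x ∈ groupCStarSubalgebra G) :
    groupFamily g * x ∈ groupCStarSubalgebra G ∧ x * groupFamily g ∈ groupCStarSubalgebra G := by
  have hle : ∀ z ∈ NonUnitalStarAlgebra.adjoin ℂ (integratedFamilies G),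
      z ∈ groupCStarSubalgebra G := fun z hz =>
    NonUnitalStarSubalgebra.le_topologicalClosure _ hz
  have main : ∀ y ∈ NonUnitalStarAlgebra.adjoin ℂ (integratedFamilies G), ∀ g : G,
      groupFamily g * y ∈ groupCStarSubalgebra G ∧ y * groupFamily g ∈ groupCStarSubalgebra G := by
    intro y hy
    induction hy using NonUnitalStarAlgebra.adjoin_induction with
    | mem x hx =>
      obtain ⟨f, hf, rfl⟩ := hx
      intro g
      rw [integratedFamily_mul_groupFamily, groupFamily_mul_integratedFamily]
      exact ⟨integratedFamily_mem _ _, integratedFamily_mem _ _⟩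
    | add x y _ _ hx hy =>
      intro g
      rw [mul_add, add_mul]
      exact ⟨add_mem (hx g).1 (hy g).1, add_mem (hx g).2 (hy g).2⟩
    | zero => intro g; simp
    | mul x y hx' hy' hx hy =>
      intro g
      rw [← mul_assoc, mul_assoc x y]
      exact ⟨mul_mem (hx g).1 (hle _ hy'), mul_mem (hle _ hx') (hy g).2⟩
    | smul r x _ hx =>
      intro g
      rw [mul_smul_comm, smul_mul_assoc]
      exact ⟨SMulMemClass.smul_mem r (hx g).1, SMulMemClass.smul_mem r (hx g).2⟩
    | star x _ hx =>
      intro g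
      constructor
      · have := star_mem (hx g⁻¹).2
        rwa [star_mul, star_groupFamily, inv_inv] at this
      · have := star_mem (hx g⁻¹).1
        rwa [star_mul, star_groupFamily, inv_inv] at this
  have hc : IsClosed (groupCStarSubalgebra G : Set (RepProduct G)) := inferInstance
  have hx' : x ∈ closure ((NonUnitalStarAlgebra.adjoin ℂ (integratedFamilies G) :
      NonUnitalStarSubalgebra ℂ (RepProduct G)) : Set (RepProduct G)) := hx
  constructor
  · refine closure_minimal (t := {x : RepProduct G | groupFamily g * x ∈ groupCStarSubalgebra G})
      (fun y hy => (main y hy g).1) ?_ hx'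
    exact hc.preimage (continuous_const_mul (groupFamily g))
  · refine closure_minimal (t := {x : RepProduct G | x * groupFamily g ∈ groupCStarSubalgebra G})
      (fun y hy => (main y hy g).2) ?_ hx'
    exact hc.preimage (continuous_mul_const (groupFamily g))

/-- Multiplication of `C⋆(G)` by `(U_g)_U`, as a multiplier. -/
def groupMultiplier (g : G) : 𝓜(ℂ, GroupCStar G) where
  fst := LinearMap.mkContinuous
    { toFun := fun x => ⟨groupFamily g * x.1, (groupFamily_mul_mem g x.2).1⟩
      map_add' := fun x y => Subtype.ext (mul_add (groupFamily g) x.1 y.1)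
      map_smul' := fun c x => Subtype.ext (mul_smul_comm c (groupFamily g) x.1) }
    ‖groupFamily g‖ fun x => norm_mul_le (groupFamily g) x.1
  snd := LinearMap.mkContinuous
    { toFun := fun x => ⟨x.1 * groupFamily g, (groupFamily_mul_mem g x.2).2⟩
      map_add' := fun x y => Subtype.ext (add_mul x.1 y.1 (groupFamily g))
      map_smul' := fun c x => Subtype.ext (smul_mul_assoc c x.1 (groupFamily g)) }
    ‖groupFamily g‖ fun x => (norm_mul_le x.1 (groupFamily g)).trans_eq (mul_comm _ _)
  central := fun x y => Subtype.ext (mul_assoc x.1 (groupFamily g) y.1)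

theorem incl_groupMultiplier_fst (g : G) (x : GroupCStar G) :
    GroupCStar.incl ((groupMultiplier g).fst x) = groupFamily g * GroupCStar.incl x := rfl

theorem incl_groupMultiplier_snd (g : G) (x : GroupCStar G) :
    GroupCStar.incl ((groupMultiplier g).snd x) = GroupCStar.incl x * groupFamily g := rfl

theorem groupMultiplier_mul (g h : G) :
    groupMultiplier (g * h) = groupMultiplier g * groupMultiplier h := by
  refine DoubleCentralizer.ext ℂ _ _ _ (Prod.ext ?_ ?_)
  · refine ContinuousLinearMap.ext fun x => GroupCStar.ext ?_
    change groupFamily (g * h) * GroupCStar.incl x =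
      groupFamily g * (groupFamily h * GroupCStar.incl x)
    rw [groupFamily_mul, mul_assoc]
  · refine ContinuousLinearMap.ext fun x => GroupCStar.ext ?_
    change GroupCStar.incl x * groupFamily (g * h) =
      (GroupCStar.incl x * groupFamily g) * groupFamily h
    rw [groupFamily_mul, mul_assoc]

theorem groupMultiplier_one : groupMultiplier (1 : G) = 1 := by
  refine DoubleCentralizer.ext ℂ _ _ _ (Prod.ext ?_ ?_)
  · exact ContinuousLinearMap.ext fun x => GroupCStar.ext (groupFamily_one_mul x.1)
  · exact ContinuousLinearMap.ext fun x => GroupCStar.ext (mul_groupFamily_one x.1)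

theorem star_groupMultiplier (g : G) : star (groupMultiplier g) = groupMultiplier g⁻¹ := by
  refine DoubleCentralizer.ext ℂ _ _ _ (Prod.ext ?_ ?_)
  · refine ContinuousLinearMap.ext fun x => GroupCStar.ext ?_
    change star (star (GroupCStar.incl x) * groupFamily g) = groupFamily g⁻¹ * GroupCStar.incl x
    rw [star_mul, star_star, star_groupFamily]
  · refine ContinuousLinearMap.ext fun x => GroupCStar.ext ?_
    change star (groupFamily g * star (GroupCStar.incl x)) = GroupCStar.incl x * groupFamily g⁻¹
    rw [star_mul, star_star, star_groupFamily]

/-- The canonical homomorphism of `G` into the unitary group of `M(C⋆(G))`. -/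
def canonicalHom : G →* unitary 𝓜(ℂ, GroupCStar G) where
  toFun g := ⟨groupMultiplier g, by
    rw [Unitary.mem_iff, star_groupMultiplier, ← groupMultiplier_mul, ← groupMultiplier_mul,
      inv_mul_cancel, mul_inv_cancel, groupMultiplier_one]
    exact ⟨rfl, rfl⟩⟩
  map_one' := Subtype.ext groupMultiplier_one
  map_mul' g h := Subtype.ext (groupMultiplier_mul g h)

end GroupAlgebra

/-! ## Extension of nondegenerate homomorphisms to multiplier algebras -/

section Multiplier

variable {L C : Type*} [NonUnitalCStarAlgebra L] [NonUnitalCStarAlgebra C]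

/-- `φ : L → M(C)` is nondegenerate: the linear span of `φ(L)C` is dense in `C`. -/
def IsNondegenerate (φ : L →⋆ₙₐ[ℂ] 𝓜(ℂ, C)) : Prop :=
  Dense (Submodule.span ℂ {x : C | ∃ (l : L) (c : C), x = (φ l).fst c} : Set C)

theorem exists_limit {X E : Type*} [NormedAddCommGroup E] [NormedSpace ℂ E] [CompleteSpace E]
    {F : Filter X} [F.NeBot] (S : X → E →L[ℂ] E) {K : ℝ} (hb : ∀ᶠ u in F, ‖S u‖ ≤ K) {D : Set E}
    (hD : Dense (Submodule.span ℂ D : Set E))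
    (h : ∀ d ∈ D, ∃ z, Tendsto (fun u => S u d) F (𝓝 z)) :
    ∃ T : E →L[ℂ] E, ∀ y, Tendsto (fun u => S u y) F (𝓝 (T y)) := by
  have hspan : ∀ d ∈ Submodule.span ℂ D, ∃ z, Tendsto (fun u => S u d) F (𝓝 z) := by
    intro d hd
    induction hd using Submodule.span_induction with
    | mem x hx => exact h x hx
    | zero => exact ⟨0, by simp⟩
    | add x y _ _ hx hy =>
      obtain ⟨z, hz⟩ := hx
      obtain ⟨w, hw⟩ := hy
      exact ⟨z + w, by simpa using hz.add hw⟩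
    | smul c x _ hx =>
      obtain ⟨z, hz⟩ := hx
      exact ⟨c • z, by simpa using hz.const_smul c⟩
  have hK : 0 ≤ K := by
    obtain ⟨u, hu⟩ := hb.exists
    exact (norm_nonneg _).trans hu
  have hall : ∀ y, ∃ z, Tendsto (fun u => S u y) F (𝓝 z) := by
    intro y
    refine cauchy_map_iff_exists_tendsto.1 ?_
    rw [Metric.cauchy_iff]
    refine ⟨inferInstance, fun ε hε => ?_⟩
    obtain ⟨d, hd, hyd⟩ := Metric.mem_closure_iff.1 (hD y) (ε / (4 * (K + 1))) (by positivity)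
    obtain ⟨z, hz⟩ := hspan d hd
    have hev : ∀ᶠ u in F, dist (S u y) z < ε / 2 := by
      filter_upwards [hb, Metric.tendsto_nhds.1 hz (ε / 4) (by positivity)] with u hu hu'
      have h1 : dist (S u y) (S u d) ≤ ε / 4 := by
        rw [dist_eq_norm, ← map_sub]
        refine ((S u).le_of_opNorm_le hu _).trans ?_
        rw [← dist_eq_norm]
        have : K * dist y d ≤ (K + 1) * (ε / (4 * (K + 1))) :=
          mul_le_mul (by linarith) hyd.le dist_nonneg (by linarith)
        refine this.trans_eq ?_
        field_simp
      calc dist (S u y) z ≤ dist (S u y) (S u d) + dist (S u d) z := dist_triangle _ _ _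
        _ < ε / 2 := by linarith
    refine ⟨(fun u => S u y) '' {u | dist (S u y) z < ε / 2}, image_mem_map hev, ?_⟩
    rintro _ ⟨u, hu, rfl⟩ _ ⟨v, hv, rfl⟩
    calc dist (S u y) (S v y) ≤ dist (S u y) z + dist (S v y) z := dist_triangle_right _ _ _
      _ < ε := by
        have h1 : dist (S u y) z < ε / 2 := hu
        have h2 : dist (S v y) z < ε / 2 := hv
        linarith
  choose T hT using hall
  refine ⟨LinearMap.mkContinuous
    { toFun := T
      map_add' := fun x y => tendsto_nhds_unique (hT (x + y)) (by simpa using (hT x).add (hT y))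
      map_smul' := fun c x =>
        tendsto_nhds_unique (hT (c • x)) (by simpa using (hT x).const_smul c) } K
    (fun y => ?_), hT⟩
  exact le_of_tendsto (hT y).norm (hb.mono fun u hu => (S u).le_of_opNorm_le hu y)

theorem multiplier_ext {S T : 𝓜(ℂ, C)} (h : ∀ y, S.fst y = T.fst y) : S = T := by
  rw [← sub_eq_zero, ← norm_eq_zero, ← DoubleCentralizer.norm_fst, norm_eq_zero]
  exact ContinuousLinearMap.ext fun y => sub_eq_zero.2 (h y)

theorem multiplier_ext_of_nondegenerate {φ : L →⋆ₙₐ[ℂ] 𝓜(ℂ, C)} (hφ : IsNondegenerate φ)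
    {S T : 𝓜(ℂ, C)} (h : ∀ l, S * φ l = T * φ l) : S = T := by
  refine multiplier_ext fun y => ?_
  have : S.fst = T.fst := by
    refine ContinuousLinearMap.ext_on hφ ?_
    rintro _ ⟨l, c, rfl⟩
    exact congrArg (fun Z : 𝓜(ℂ, C) => Z.fst c) (h l)
  rw [this]

theorem fst_mul_right (m : 𝓜(ℂ, L)) (u l : L) : m.fst u * l = m.fst (u * l) := by
  have h : ∀ x : L, x * (m.fst u * l - m.fst (u * l)) = 0 := fun x => by
    rw [mul_sub, ← mul_assoc, ← m.central, ← m.central, mul_assoc, sub_self]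
  have := h (star (m.fst u * l - m.fst (u * l)))
  exact sub_eq_zero.1 (CStarRing.star_mul_self_eq_zero_iff _ |>.1 this)

theorem tendsto_fst_apply {X : Type*} {F : Filter X} {S : X → 𝓜(ℂ, C)} {T : 𝓜(ℂ, C)}
    (h : Tendsto S F (𝓝 T)) (c : C) : Tendsto (fun u => (S u).fst c) F (𝓝 (T.fst c)) := by
  rw [tendsto_iff_norm_sub_tendsto_zero] at h ⊢
  refine squeeze_zero (fun _ => norm_nonneg _) (fun u => ?_) (by simpa using h.mul_const ‖c‖)
  exact (S u - T).fst.le_of_opNorm_le (DoubleCentralizer.norm_fst _).le c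

theorem tendsto_snd_apply {X : Type*} {F : Filter X} {S : X → 𝓜(ℂ, C)} {T : 𝓜(ℂ, C)}
    (h : Tendsto S F (𝓝 T)) (c : C) : Tendsto (fun u => (S u).snd c) F (𝓝 (T.snd c)) := by
  rw [tendsto_iff_norm_sub_tendsto_zero] at h ⊢
  refine squeeze_zero (fun _ => norm_nonneg _) (fun u => ?_) (by simpa using h.mul_const ‖c‖)
  exact (S u - T).snd.le_of_opNorm_le (DoubleCentralizer.norm_snd _).le c

theorem coe_mul_multiplier (m : 𝓜(ℂ, L)) (l : L) : m * (l : 𝓜(ℂ, L)) = ((m.fst l : L) : 𝓜(ℂ, L)) :=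
  multiplier_ext fun y => (fst_mul_right m l y).symm

theorem exists_extension_aux {φ : L →⋆ₙₐ[ℂ] 𝓜(ℂ, C)} (hφ : IsNondegenerate φ) (m : 𝓜(ℂ, L)) :
    ∃ T : 𝓜(ℂ, C), ∀ l, T * φ l = φ (m.fst l) := by
  let _ := CStarAlgebra.spectralOrder L
  have _ := CStarAlgebra.spectralOrderedRing L
  have hF := CStarAlgebra.increasingApproximateUnit L
  set F := CStarAlgebra.approximateUnit L
  have hb : ∀ᶠ u in F, ‖φ (m.fst u)‖ ≤ ‖m‖ := by
    filter_upwards [hF.eventually_norm] with u hu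
    refine (NonUnitalStarAlgHom.norm_apply_le φ _).trans ?_
    simpa using m.fst.le_of_opNorm_le_of_le (DoubleCentralizer.norm_fst m).le hu
  have hcont : Continuous φ := AddMonoidHomClass.continuous_of_bound φ 1 fun l => by
    simpa using NonUnitalStarAlgHom.norm_apply_le φ l
  have hleft : ∀ l, Tendsto (fun u => φ (m.fst u) * φ l) F (𝓝 (φ (m.fst l))) := by
    intro l
    have h1 : ∀ u, φ (m.fst u) * φ l = φ (m.fst (u * l)) := fun u => by
      rw [← map_mul, fst_mul_right]
    simp only [h1]
    exact ((hcont.comp m.fst.continuous).tendsto _).comp (hF.tendsto_mul_right l)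
  have hright : ∀ l, Tendsto (fun u => φ l * φ (m.fst u)) F (𝓝 (φ (m.snd l))) := by
    intro l
    have h1 : ∀ u, φ l * φ (m.fst u) = φ (m.snd l * u) := fun u => by
      rw [← map_mul, m.central]
    simp only [h1]
    exact (hcont.tendsto _).comp (hF.tendsto_mul_left (m.snd l))
  obtain ⟨T, hT⟩ := exists_limit (F := F) (fun u => (φ (m.fst u)).fst)
    (hb.mono fun u hu => (DoubleCentralizer.norm_fst _).le.trans hu) hφ (by
      rintro _ ⟨l, c, rfl⟩
      exact ⟨(φ (m.fst l)).fst c, tendsto_fst_apply (hleft l) c⟩)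
  have hφ' : Dense (Submodule.span ℂ {x : C | ∃ (l : L) (c : C), x = (φ l).snd c} : Set C) := by
    have hs : ∀ x ∈ Submodule.span ℂ {x : C | ∃ (l : L) (c : C), x = (φ l).fst c},
        star x ∈ Submodule.span ℂ {x : C | ∃ (l : L) (c : C), x = (φ l).snd c} := by
      intro x hx
      induction hx using Submodule.span_induction with
      | mem x hx =>
        obtain ⟨l, c, rfl⟩ := hx
        refine Submodule.subset_span ⟨star l, star c, ?_⟩
        rw [map_star φ, DoubleCentralizer.star_snd, star_star]
      | zero => simp
      | add x y _ _ hx hy => rw [star_add]; exact add_mem hx hy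
      | smul c x _ hx => rw [star_smul]; exact Submodule.smul_mem _ _ hx
    have h2 : Dense (star '' (Submodule.span ℂ {x : C | ∃ (l : L) (c : C), x = (φ l).fst c} :
        Set C)) :=
      (star_involutive.surjective.denseRange).dense_image continuous_star hφ
    refine h2.mono ?_
    rintro _ ⟨x, hx, rfl⟩
    exact hs x hx
  obtain ⟨R, hR⟩ := exists_limit (F := F) (fun u => (φ (m.fst u)).snd)
    (hb.mono fun u hu => (DoubleCentralizer.norm_snd _).le.trans hu) hφ' (by
      rintro _ ⟨l, c, rfl⟩
      exact ⟨(φ (m.snd l)).snd c, tendsto_snd_apply (hright l) c⟩)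
  refine ⟨⟨(T, R), fun x y => ?_⟩, fun l => multiplier_ext fun y => ?_⟩
  · refine tendsto_nhds_unique ((hR x).mul_const y) ?_
    simp only [DoubleCentralizer.central]
    exact (hT y).const_mul x
  · exact tendsto_nhds_unique (hT ((φ l).fst y)) (tendsto_fst_apply (hleft l) y)

/-- A nondegenerate homomorphism `φ : L → M(C)` extends to exactly one unital `⋆`-homomorphism
`M(L) → M(C)`. -/
theorem existsUnique_multiplierExtension {φ : L →⋆ₙₐ[ℂ] 𝓜(ℂ, C)} (hφ : IsNondegenerate φ) :
    ∃! ψ : 𝓜(ℂ, L) →⋆ₐ[ℂ] 𝓜(ℂ, C), ∀ l : L, ψ l = φ l := by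
  choose T hT using exists_extension_aux hφ
  have huniq : ∀ m S, (∀ l, S * φ l = φ (m.fst l)) → S = T m := fun m S hS =>
    multiplier_ext_of_nondegenerate hφ fun l => (hS l).trans (hT m l).symm
  refine ⟨
    { toFun := T
      map_one' := (huniq _ _ fun l => by rw [one_mul]; rfl).symm
      map_mul' := fun m n => (huniq _ _ fun l => by rw [mul_assoc, hT, hT]; rfl).symm
      map_zero' := (huniq _ _ fun l => by
        rw [zero_mul]; exact (map_zero φ).symm).symm
      map_add' := fun m n => (huniq _ _ fun l => by
        rw [add_mul, hT, hT, ← map_add]; rfl).symm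
      commutes' := fun c => (huniq _ _ fun l => by
        rw [Algebra.algebraMap_eq_smul_one, smul_mul_assoc, one_mul, ← map_smul,
          Algebra.algebraMap_eq_smul_one]; rfl).symm
      map_star' := fun m => (huniq _ _ fun l => by
        have hz : ∀ l', φ l' * (star (T m) * φ l) = φ l' * φ ((star m).fst l) := by
          intro l'
          rw [← mul_assoc, ← map_mul]
          have h1 : φ l' * star (T m) = star (φ (m.fst (star l'))) := by
            rw [← hT, star_mul, ← map_star, star_star]
          rw [h1, ← map_star, ← map_mul, ← (star m).central]
          rfl
        refine sub_eq_zero.1 (star_eq_zero.1 (multiplier_ext_of_nondegenerate hφ fun l' => ?_))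
        rw [zero_mul, ← star_eq_zero, star_mul, star_star, ← map_star, mul_sub, hz, sub_self]).symm },
    fun l => ?_, fun ψ hψ => ?_⟩
  · exact (huniq _ _ fun l' => by rw [← map_mul]; rfl).symm
  · refine StarAlgHom.ext fun m => huniq _ _ fun l => ?_
    rw [← hψ, ← map_mul, coe_mul_multiplier, hψ]

/-- The extension `M(L) → M(C)` of a nondegenerate homomorphism `L → M(C)`. -/
def multiplierExtension {φ : L →⋆ₙₐ[ℂ] 𝓜(ℂ, C)} (hφ : IsNondegenerate φ) :
    𝓜(ℂ, L) →⋆ₐ[ℂ] 𝓜(ℂ, C) :=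
  (existsUnique_multiplierExtension hφ).choose

theorem multiplierExtension_coe {φ : L →⋆ₙₐ[ℂ] 𝓜(ℂ, C)} (hφ : IsNondegenerate φ) (l : L) :
    multiplierExtension hφ l = φ l :=
  (existsUnique_multiplierExtension hφ).choose_spec.1 l

/-- The extension to `M(C)` of an automorphism `θ` of `C`. -/
def extendAut (θ : C ≃⋆ₐ[ℂ] C) (m : 𝓜(ℂ, C)) : 𝓜(ℂ, C) where
  fst := LinearMap.mkContinuous
    { toFun := fun x => θ (m.fst (θ.symm x))
      map_add' := fun x y => by simp only [map_add]
      map_smul' := fun c x => by simp only [map_smul, RingHom.id_apply] }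
    ‖m‖ fun x => by
      refine (NonUnitalStarAlgHom.norm_apply_le θ _).trans ?_
      refine (m.fst.le_of_opNorm_le (DoubleCentralizer.norm_fst m).le _).trans ?_
      exact mul_le_mul_of_nonneg_left (NonUnitalStarAlgHom.norm_apply_le θ.symm x) (norm_nonneg _)
  snd := LinearMap.mkContinuous
    { toFun := fun x => θ (m.snd (θ.symm x))
      map_add' := fun x y => by simp only [map_add]
      map_smul' := fun c x => by simp only [map_smul, RingHom.id_apply] }
    ‖m‖ fun x => by
      refine (NonUnitalStarAlgHom.norm_apply_le θ _).trans ?_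
      refine (m.snd.le_of_opNorm_le (DoubleCentralizer.norm_snd m).le _).trans ?_
      exact mul_le_mul_of_nonneg_left (NonUnitalStarAlgHom.norm_apply_le θ.symm x) (norm_nonneg _)
  central := fun x y => by
    change θ (m.snd (θ.symm x)) * y = x * θ (m.fst (θ.symm y))
    have h := congrArg θ (m.central (θ.symm x) (θ.symm y))
    simpa using h

theorem extendAut_coe (θ : C ≃⋆ₐ[ℂ] C) (c : C) : extendAut θ (c : 𝓜(ℂ, C)) = (θ c : 𝓜(ℂ, C)) :=
  multiplier_ext fun y => by
    change θ (c * θ.symm y) = θ c * y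
    simp

end Multiplier

/-! ## `G`-products and the Landstad conditions -/

section Landstad

variable (G : Type*) [CommGroup G] [TopologicalSpace G]

/-- The structure of a `G`-product on a C⋆-algebra `B`, for an abelian group `G`. -/
structure GProduct (B : Type*) [NonUnitalCStarAlgebra B] where
  /-- The homomorphism `λ` of `G` into the unitary group of `M(B)`. -/
  lam : G →* unitary 𝓜(ℂ, B)
  continuous_lam : ∀ y : B, Continuous fun g => (lam g : 𝓜(ℂ, B)).fst y
  /-- The action of the dual group on `B`. -/
  dual : PontryaginDual G →* (B ≃⋆ₐ[ℂ] B)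
  continuous_dual : ∀ y : B, Continuous fun τ => dual τ y
  dual_lam : ∀ (g : G) (τ : PontryaginDual G),
    extendAut (dual τ) (lam g) = ((τ g : Circle) : ℂ) • (lam g : 𝓜(ℂ, B))

variable {G} {B : Type*} [NonUnitalCStarAlgebra B]

namespace GProduct

theorem norm_lam_fst_le (P : GProduct G B) (g : G) (y : B) :
    ‖(P.lam g : 𝓜(ℂ, B)).fst y‖ ≤ ‖y‖ := by
  simpa using (P.lam g : 𝓜(ℂ, B)).fst.le_of_opNorm_le
    ((DoubleCentralizer.norm_fst _).le.trans (norm_unitary_le (P.lam g))) y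

theorem norm_lam_snd_le (P : GProduct G B) (g : G) (y : B) :
    ‖(P.lam g : 𝓜(ℂ, B)).snd y‖ ≤ ‖y‖ := by
  simpa using (P.lam g : 𝓜(ℂ, B)).snd.le_of_opNorm_le
    ((DoubleCentralizer.norm_snd _).le.trans (norm_unitary_le (P.lam g))) y

variable [IsTopologicalGroup G]

theorem continuous_lam_snd (P : GProduct G B) (y : B) :
    Continuous fun g => (P.lam g : 𝓜(ℂ, B)).snd y := by
  have h : ∀ g, (P.lam g : 𝓜(ℂ, B)).snd y = star ((P.lam g⁻¹ : 𝓜(ℂ, B)).fst (star y)) := by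
    intro g
    rw [map_inv, ← Unitary.star_eq_inv, Unitary.coe_star, DoubleCentralizer.star_fst, star_star,
      star_star]
  simp only [h]
  exact continuous_star.comp ((P.continuous_lam (star y)).comp continuous_inv)

variable [T2Space G] [LocallyCompactSpace G] [MeasurableSpace G] [BorelSpace G]

/-- The multiplier `λ_f = ∫ f(g) λ_g dg` (a strictly convergent integral), for `f ∈ L¹(G)`. -/
def lamL1 (P : GProduct G B) (f : G → ℂ) (hf : Integrable f (Measure.haar (G := G))) :
    𝓜(ℂ, B) where
  fst := smear (fun g => (P.lam g : 𝓜(ℂ, B)).fst) P.continuous_lam P.norm_lam_fst_le f hf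
  snd := smear (fun g => (P.lam g : 𝓜(ℂ, B)).snd) P.continuous_lam_snd P.norm_lam_snd_le f hf
  central := fun x y => by
    have h1 := integrable_smul hf (P.continuous_lam_snd x) fun g => P.norm_lam_snd_le g x
    have h2 := integrable_smul hf (P.continuous_lam y) fun g => P.norm_lam_fst_le g y
    have e1 := ContinuousLinearMap.integral_comp_comm ((ContinuousLinearMap.mul ℂ B).flip y) h1
    have e2 := ContinuousLinearMap.integral_comp_comm (ContinuousLinearMap.mul ℂ B x) h2
    simp only [ContinuousLinearMap.flip_apply, ContinuousLinearMap.mul_apply'] at e1 e2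
    change (∫ g, f g • (P.lam g : 𝓜(ℂ, B)).snd x ∂(Measure.haar (G := G))) * y =
      x * ∫ g, f g • (P.lam g : 𝓜(ℂ, B)).fst y ∂(Measure.haar (G := G))
    rw [← e1, ← e2]
    refine integral_congr_ae (Eventually.of_forall fun g => ?_)
    simp only [smul_mul_assoc, mul_smul_comm, DoubleCentralizer.central]

/-- (L1): `x` is fixed by the dual action. -/
def IsDualInvariant (P : GProduct G B) (x : 𝓜(ℂ, B)) : Prop :=
  ∀ τ : PontryaginDual G, extendAut (P.dual τ) x = x

/-- (L2): `x λ_f` and `λ_f x` belong to `B` for all `f ∈ L¹(G)`. -/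
def SmoothsIntoAlgebra (P : GProduct G B) (x : 𝓜(ℂ, B)) : Prop :=
  ∀ (f : G → ℂ) (hf : Integrable f (Measure.haar (G := G))),
    (∃ b : B, x * P.lamL1 f hf = (b : 𝓜(ℂ, B))) ∧ ∃ b : B, P.lamL1 f hf * x = (b : 𝓜(ℂ, B))

/-- The orbit map `g ↦ λ_g x λ_{g⁻¹}`. -/
def orbitMap (P : GProduct G B) (x : 𝓜(ℂ, B)) (g : G) : 𝓜(ℂ, B) :=
  (P.lam g : 𝓜(ℂ, B)) * x * (P.lam g⁻¹ : 𝓜(ℂ, B))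

/-- The Landstad algebra: (L1), (L2) and norm continuity of the orbit map. -/
def landstadAlgebra (P : GProduct G B) : Set 𝓜(ℂ, B) :=
  {x | P.IsDualInvariant x ∧ P.SmoothsIntoAlgebra x ∧ Continuous (P.orbitMap x)}

/-- The weak Landstad algebra: (L1), (L2) and strict continuity of the orbit map. -/
def weakLandstadAlgebra (P : GProduct G B) : Set 𝓜(ℂ, B) :=
  {x | P.IsDualInvariant x ∧ P.SmoothsIntoAlgebra x ∧
    ∀ b : B, (Continuous fun g => (P.orbitMap x g).fst b) ∧
      Continuous fun g => (P.orbitMap x g).snd b}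

end GProduct

end Landstad

/-! ## Full crossed product hosts -/

section Host

variable {G A C : Type u} [CommGroup G] [TopologicalSpace G] [IsTopologicalGroup G] [T2Space G]
  [LocallyCompactSpace G] [MeasurableSpace G] [BorelSpace G]
  [NonUnitalCStarAlgebra A] [NonUnitalCStarAlgebra C]

/-- `(π, U)` is a covariant representation of `(A, G, α)` (with `π` nondegenerate). -/
def IsCovariant (α : G →* (A ≃⋆ₐ[ℂ] A)) (U : UnitaryRep G)
    (π : A →⋆ₙₐ[ℂ] (U.space →L[ℂ] U.space)) : Prop :=
  Dense (Submodule.span ℂ {w : U.space | ∃ (a : A) (v : U.space), w = π a v} : Set U.space) ∧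
  ∀ (g : G) (a : A), (U.toHom g : U.space →L[ℂ] U.space) * π a *
    star (U.toHom g : U.space →L[ℂ] U.space) = π (α g a)

/-- `(C, ηA, ηL)` is a crossed product host for `(α, C⋆(G))`. -/
structure IsCrossedProductHost (α : G →* (A ≃⋆ₐ[ℂ] A)) (ηA : A →⋆ₙₐ[ℂ] 𝓜(ℂ, C))
    (ηL : GroupCStar G →⋆ₙₐ[ℂ] 𝓜(ℂ, C)) : Prop where
  nondegenerate : IsNondegenerate ηL
  covariant : ∀ (g : G) (a : A),
    multiplierExtension nondegenerate (canonicalHom g : 𝓜(ℂ, GroupCStar G)) * ηA a *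
      star (multiplierExtension nondegenerate (canonicalHom g : 𝓜(ℂ, GroupCStar G))) = ηA (α g a)
  mul_mem : ∀ (a : A) (l : GroupCStar G), ∃ c : C, ηA a * ηL l = (c : 𝓜(ℂ, C))
  generates : (NonUnitalStarAlgebra.adjoin ℂ
    {c : C | ∃ (a : A) (l : GroupCStar G), ηA a * ηL l = (c : 𝓜(ℂ, C))}).topologicalClosure = ⊤

/-- `(C, ηA, ηL)` is a full crossed product host for `(α, C⋆(G))`. -/
structure IsFullCrossedProductHost (α : G →* (A ≃⋆ₐ[ℂ] A)) (ηA : A →⋆ₙₐ[ℂ] 𝓜(ℂ, C))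
    (ηL : GroupCStar G →⋆ₙₐ[ℂ] 𝓜(ℂ, C)) : Prop extends IsCrossedProductHost α ηA ηL where
  full : ∀ (U : UnitaryRep G) (π : A →⋆ₙₐ[ℂ] (U.space →L[ℂ] U.space)), IsCovariant α U π →
    ∃! ρ : C →⋆ₙₐ[ℂ] (U.space →L[ℂ] U.space), ∀ (a : A) (l : GroupCStar G) (c : C),
      ηA a * ηL l = (c : 𝓜(ℂ, C)) → ρ c = π a * U.integratedRep l

/-- Multiplication of an integrable function by a character. -/
theorem integrable_character_mul (τ : PontryaginDual G) {f : G → ℂ}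
    (hf : Integrable f (Measure.haar (G := G))) :
    Integrable (fun g => ((τ g : Circle) : ℂ) * f g) (Measure.haar (G := G)) := by
  have hτ : Continuous fun g => ((τ g : Circle) : ℂ) :=
    continuous_induced_dom.comp (map_continuous τ)
  have h := integrable_smul hf hτ (c := 1) fun g => (Circle.norm_coe (τ g)).le
  exact h.congr (Eventually.of_forall fun g => mul_comm _ _)

/-- `P` is the canonical `G`-product structure of the crossed product host `C`: `λ` is the
extension of `ηL` composed with `G → UM(C⋆(G))`, and the dual group acts by the dual action, which
carries `ηA(a)ηL(f)` into `ηA(a)ηL(τf)`, for `a ∈ A`, `f ∈ L¹(G)` and `τ` a character. -/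
structure IsCanonicalGProduct {α : G →* (A ≃⋆ₐ[ℂ] A)} {ηA : A →⋆ₙₐ[ℂ] 𝓜(ℂ, C)}
    {ηL : GroupCStar G →⋆ₙₐ[ℂ] 𝓜(ℂ, C)} (h : IsCrossedProductHost α ηA ηL)
    (P : GProduct G C) : Prop where
  lam_eq : ∀ g : G, (P.lam g : 𝓜(ℂ, C)) =
    multiplierExtension h.nondegenerate (canonicalHom g : 𝓜(ℂ, GroupCStar G))
  dual_eq : ∀ (τ : PontryaginDual G) (a : A) (f : G → ℂ)
    (hf : Integrable f (Measure.haar (G := G))) (c : C),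
    ηA a * ηL (ofL1 f hf) = (c : 𝓜(ℂ, C)) →
      ((P.dual τ c : C) : 𝓜(ℂ, C)) = ηA a *
        ηL (ofL1 (fun g => ((τ g : Circle) : ℂ) * f g) (integrable_character_mul τ hf))

end Host

end CPHost

end

/-! The map `λ` is prescribed, and `C⋆(G)` is the closed linear span of `L¹(G)`. Since the products
`ηA(a)ηL(l)` generate `C`, the prescribed values determine the dual action as well, so uniqueness is
a density argument (`IsCrossedProductHost.hom_ext`). Strong continuity of `λ` comes from
nondegeneracy of `ηL` and continuity of translation in `L¹(G)`.

The substance is the existence of the dual action. Multiplication by a character `τ` gives an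
endomorphism `GroupCStar.twist τ` of `C⋆(G)`, since `U ↦ τU` maps the unitary representations of `G`
into themselves. To carry it over to `C`, take the closed `⋆`-subalgebra `K` of `C × C` generated by
the pairs `(ηA(a)ηL(l), ηA(a)ηL(τl))`, and show that it is the graph of a homomorphism
(`exists_starHom_of_generators`). If `(0, y) ∈ K` with `y ≠ 0`, a GNS representation `ρ` has `ρ(y) ≠
0`. Extended to `M(C)`, it gives a covariant pair `(π, U)`, and `(π, τU)` is again covariant.
Fullness of the host turns it into a representation `ρ'` with `ρ'(p.1) = ρ(p.2)` on the generators,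
hence on `K`, so `ρ(y) = ρ'(0) = 0`, a contradiction. Covariance of `(π, U)` includes nondegeneracy
of `π`, which rests on the density of the span of `ηA(A)C` (`dense_span_left`).

For the Landstad algebras, norm convergence in `M(C)` implies strict convergence. For `x = ηA(a)`,
(L1) holds because the dual action leaves the `A`-factor of a product alone, and (L2) because `λ_f =
ηL(f)`. The orbit map of `x` is strictly continuous because `λ` is, although `g ↦ ηA(α_g(a))` need
not be norm continuous. -/

noncomputable section

namespace CPHost

/-! ### Density, integration and generation arguments -/

section Density

variable {X E F : Type*} [TopologicalSpace X] [NormedAddCommGroup E] [NormedSpace ℂ E]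
  [NormedAddCommGroup F] [NormedSpace ℂ F]

/-- A family of contractions that is strongly continuous on a total set is strongly continuous. -/
theorem continuous_apply_of_dense (T : X → E →ₗ[ℂ] F) (hT : ∀ x v, ‖T x v‖ ≤ ‖v‖) {D : Set E}
    (hD : Dense (Submodule.span ℂ D : Set E)) (h : ∀ d ∈ D, Continuous fun x => T x d) (v : E) :
    Continuous fun x => T x v := by
  have hspan : ∀ d ∈ Submodule.span ℂ D, Continuous fun x => T x d := by
    intro d hd
    induction hd using Submodule.span_induction with
    | mem x hx => exact h x hx
    | zero => simpa using continuous_const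
    | add x y _ _ hx hy => simp only [map_add]; exact hx.add hy
    | smul c x _ hx => simp only [map_smul]; exact hx.const_smul c
  refine continuous_of_uniform_approx_of_continuous fun u hu => ?_
  obtain ⟨ε, hε, hεu⟩ := Metric.mem_uniformity_dist.1 hu
  obtain ⟨d, hd, hvd⟩ := Metric.mem_closure_iff.1 (hD v) ε hε
  refine ⟨fun x => T x d, hspan d hd, fun x => hεu ?_⟩
  rw [dist_eq_norm, ← map_sub]
  exact (hT x _).trans_lt (by rwa [← dist_eq_norm])

/-- The quotient map by `T` is continuous, commutes with the integral and kills the integrand. A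
non-integrable `R` has integral `0` by convention, which also lies in `T`. -/
theorem integral_mem_of_isClosed {Y : Type*} [MeasurableSpace Y] {μ : Measure Y} [CompleteSpace E]
    {T : Submodule ℂ E} (hT : IsClosed (T : Set E)) {R : Y → E} (hR : ∀ y, R y ∈ T) :
    ∫ y, R y ∂μ ∈ T := by
  by_cases hi : Integrable R μ
  · have e := T.mkQL.integral_comp_comm hi
    have h0 : ∀ y, T.mkQL (R y) = 0 := fun y => (Submodule.Quotient.mk_eq_zero T).2 (hR y)
    simp only [h0, integral_zero] at e
    exact (Submodule.Quotient.mk_eq_zero T).1 e.symm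
  · rw [integral_undef hi]
    exact T.zero_mem

end Density

section AdjoinInduction

variable {E : Type*} [NonUnitalCStarAlgebra E]

theorem dense_adjoin_induction {s : Set E}
    (hs : (NonUnitalStarAlgebra.adjoin ℂ s).topologicalClosure = ⊤) {p : E → Prop}
    (closed : IsClosed {x | p x}) (mem : ∀ x ∈ s, p x) (zero : p 0)
    (add : ∀ x y, p x → p y → p (x + y)) (mul : ∀ x y, p x → p y → p (x * y))
    (smul : ∀ (c : ℂ) x, p x → p (c • x)) (star' : ∀ x, p x → p (star x)) (x : E) : p x := by
  have hx : x ∈ (NonUnitalStarAlgebra.adjoin ℂ s).topologicalClosure := hs ▸ trivial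
  refine closure_minimal (s := (NonUnitalStarAlgebra.adjoin ℂ s : Set E)) (fun y hy => ?_)
    closed hx
  change p y
  induction hy using NonUnitalStarAlgebra.adjoin_induction with
  | mem x hx => exact mem x hx
  | add x y _ _ hx hy => exact add x y hx hy
  | zero => exact zero
  | mul x y _ _ hx hy => exact mul x y hx hy
  | smul r x _ hx => exact smul r x hx
  | star x _ hx => exact star' x hx

end AdjoinInduction

theorem RepProduct.norm_le_of_forall_le {G : Type u} [Group G] [TopologicalSpace G]
    {x : RepProduct G} {c : ℝ} (hc : 0 ≤ c)
    (h : ∀ U, ‖RepProduct.eval U x‖ ≤ c) : ‖x‖ ≤ c :=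
  lp.norm_le_of_forall_le hc h

/-! ### `L¹(G)` inside the group C⋆-algebra -/

section GroupAlgebraLemmas

variable {G : Type u} [CommGroup G] [TopologicalSpace G] [IsTopologicalGroup G] [T2Space G]
  [LocallyCompactSpace G] [MeasurableSpace G] [BorelSpace G]

theorem GroupCStar.norm_incl (x : GroupCStar G) : ‖GroupCStar.incl x‖ = ‖x‖ := rfl

theorem norm_integratedFamily_le (f : G → ℂ) (hf : Integrable f (Measure.haar (G := G))) :
    ‖integratedFamily f hf‖ ≤ ∫ g, ‖f g‖ ∂(Measure.haar (G := G)) :=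
  RepProduct.norm_le_of_forall_le (integral_nonneg fun _ => norm_nonneg _)
    fun U => norm_smear_le _ U.continuous_apply U.norm_apply_le f hf

theorem UnitaryRep.integrated_apply (U : UnitaryRep G) (f : G → ℂ)
    (hf : Integrable f (Measure.haar (G := G))) (v : U.space) :
    U.integrated f hf v =
      ∫ g, f g • (U.toHom g : U.space →L[ℂ] U.space) v ∂(Measure.haar (G := G)) := rfl

theorem UnitaryRep.integrable (U : UnitaryRep G) {f : G → ℂ}
    (hf : Integrable f (Measure.haar (G := G))) (v : U.space) :
    Integrable (fun g => f g • (U.toHom g : U.space →L[ℂ] U.space) v)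
      (Measure.haar (G := G)) :=
  integrable_smul hf (U.continuous_apply v) fun g => U.norm_apply_le g v

theorem integratedFamily_sub (f h : G → ℂ) (hf : Integrable f (Measure.haar (G := G)))
    (hh : Integrable h (Measure.haar (G := G))) :
    integratedFamily f hf - integratedFamily h hh =
      integratedFamily (fun g => f g - h g) (hf.sub hh) := by
  refine RepProduct.ext fun U => ContinuousLinearMap.ext fun v => ?_
  rw [map_sub]
  change U.integrated f hf v - U.integrated h hh v =
    U.integrated (fun g => f g - h g) (hf.sub hh) v
  simp only [UnitaryRep.integrated_apply, sub_smul]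
  exact (integral_sub (U.integrable hf v) (U.integrable hh v)).symm

theorem norm_ofL1_sub_le (f h : G → ℂ) (hf : Integrable f (Measure.haar (G := G)))
    (hh : Integrable h (Measure.haar (G := G))) :
    ‖ofL1 f hf - ofL1 h hh‖ ≤ ∫ g, ‖f g - h g‖ ∂(Measure.haar (G := G)) := by
  rw [← GroupCStar.norm_incl, map_sub]
  change ‖integratedFamily f hf - integratedFamily h hh‖ ≤ _
  rw [integratedFamily_sub]
  exact norm_integratedFamily_le _ _

/-- The adjoint of `U(f)` is `U(f*)` with `f*(g)` the conjugate of `f(g⁻¹)`. There is no modular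
function, because `G` is abelian and Haar measure is invariant under inversion. -/
theorem star_integratedFamily (f : G → ℂ) (hf : Integrable f (Measure.haar (G := G))) :
    star (integratedFamily f hf) ∈ integratedFamilies G := by
  have hf' : Integrable (fun g => (starRingEnd ℂ) (f g⁻¹)) (Measure.haar (G := G)) :=
    (LinearIsometryEquiv.integrable_comp_iff (RCLike.conjLIE (K := ℂ))).2 hf.comp_inv
  refine ⟨_, hf', RepProduct.ext fun U => ?_⟩
  rw [map_star]
  change star (U.integrated f hf) = U.integrated _ hf'
  refine (ContinuousLinearMap.eq_adjoint_iff (U.integrated _ hf') (U.integrated f hf)).2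
    (fun v w => ?_) |>.symm
  have e1 := integral_inner (𝕜 := ℂ) (U.integrable hf w) v
  have e2 := integral_inner (𝕜 := ℂ) (U.integrable hf' v) w
  rw [← inner_conj_symm, UnitaryRep.integrated_apply, UnitaryRep.integrated_apply, ← e1, ← e2,
    ← integral_conj, ← integral_inv_eq_self]
  refine integral_congr_ae (Eventually.of_forall fun g => ?_)
  simp only [inv_inv, inner_smul_right, map_inv, ← Unitary.star_eq_inv, Unitary.coe_star,
    ContinuousLinearMap.star_eq_adjoint, ContinuousLinearMap.adjoint_inner_right, map_mul,
    Complex.conj_conj, inner_conj_symm]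

/-- Translation is strongly continuous on `L¹(G)`, and the C⋆-norm is dominated by the `L¹`-norm. -/
theorem continuous_translate_ofL1 (f : G → ℂ) (hf : Integrable f (Measure.haar (G := G))) :
    Continuous fun g : G => ofL1 (fun h => f (g⁻¹ * h)) (hf.comp_mul_left g⁻¹) := by
  have : Fact ((1 : ℝ≥0∞) ≠ ∞) := ⟨ENNReal.one_ne_top⟩
  set F : Lp ℂ 1 (Measure.haar (G := G)) := (memLp_one_iff_integrable.2 hf).toLp f with hF
  have hc : Continuous fun g : G => DomMulAct.mk g⁻¹ • F :=
    (DomMulAct.continuous_mk.comp continuous_inv).smul continuous_const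
  refine continuous_iff_continuousAt.2 fun g₀ => ?_
  have h0 := tendsto_iff_norm_sub_tendsto_zero.1 (hc.tendsto g₀)
  refine tendsto_iff_norm_sub_tendsto_zero.2
    (squeeze_zero (fun _ => norm_nonneg _) (fun g => ?_) h0)
  refine (norm_ofL1_sub_le _ _ _ _).trans_eq ?_
  rw [hF, DomMulAct.mk_smul_toLp, DomMulAct.mk_smul_toLp, ← MemLp.toLp_sub, Lp.norm_toLp,
    eLpNorm_one_eq_lintegral_enorm, integral_norm_eq_lintegral_enorm]
  · rfl
  · exact ((hf.comp_mul_left g⁻¹).sub (hf.comp_mul_left g₀⁻¹)).aestronglyMeasurable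

theorem groupMultiplier_fst_ofL1 (g : G) (f : G → ℂ) (hf : Integrable f (Measure.haar (G := G))) :
    (groupMultiplier g).fst (ofL1 f hf) =
      ofL1 (fun h => f (g⁻¹ * h)) (hf.comp_mul_left g⁻¹) :=
  GroupCStar.ext (groupFamily_mul_integratedFamily g f hf)

theorem norm_groupMultiplier_fst_le (g : G) (l : GroupCStar G) :
    ‖(groupMultiplier g).fst l‖ ≤ ‖l‖ := by
  simpa using (groupMultiplier g).fst.le_of_opNorm_le
    ((DoubleCentralizer.norm_fst _).le.trans (norm_unitary_le (canonicalHom g))) l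

/-- Continuity of the orbit of `l` is a hypothesis to avoid circularity: it is derived for all `l`
from the density of `L¹(G)`, whose proof uses this formula for `l` in `L¹(G)`. -/
theorem ofL1_mul_of_continuous (f : G → ℂ) (hf : Integrable f (Measure.haar (G := G)))
    (l : GroupCStar G) (hl : Continuous fun g => (groupMultiplier g).fst l) :
    ofL1 f hf * l = ∫ g, f g • (groupMultiplier g).fst l ∂(Measure.haar (G := G)) := by
  have hint := integrable_smul hf hl fun g => norm_groupMultiplier_fst_le g l
  refine GroupCStar.ext (RepProduct.ext fun U => ContinuousLinearMap.ext fun v => ?_)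
  change U.integrated f hf (U.integratedRep l v) = U.integratedRep _ v
  have hcont : Continuous fun x : GroupCStar G => U.integratedRep x v :=
    (ContinuousLinearMap.apply ℂ U.space v).continuous.comp
      (AddMonoidHomClass.continuous_of_bound U.integratedRep 1 fun l => by
        simpa using NonUnitalStarAlgHom.norm_apply_le U.integratedRep l)
  let Φ : GroupCStar G →L[ℂ] U.space :=
    ⟨{ toFun := fun x => U.integratedRep x v
       map_add' := fun x y => by simp
       map_smul' := fun c x => by simp }, hcont⟩
  change _ = Φ _
  rw [← Φ.integral_comp_comm hint, UnitaryRep.integrated_apply]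
  refine integral_congr_ae (Eventually.of_forall fun g => ?_)
  simp only [map_smul]
  rfl

variable (G) in
-- `C⋆(G)` is defined by generators, so the closed span `T` of `L¹(G)` has to be shown to be a
-- `⋆`-subalgebra. Convolution is not needed: a product of two `L¹`-elements is an integral of
-- multiples of translates, all of which lie in the closed subspace `T`.
theorem dense_span_ofL1 : Dense (Submodule.span ℂ {l : GroupCStar G |
    ∃ (f : G → ℂ) (hf : Integrable f (Measure.haar (G := G))), l = ofL1 f hf} :
      Set (GroupCStar G)) := by
  set S := Submodule.span ℂ {l : GroupCStar G |
    ∃ (f : G → ℂ) (hf : Integrable f (Measure.haar (G := G))), l = ofL1 f hf} with hS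
  set T := S.topologicalClosure with hT
  have hTc : IsClosed (T : Set (GroupCStar G)) := S.isClosed_topologicalClosure
  have hgen : ∀ f hf, ofL1 (G := G) f hf ∈ T := fun f hf =>
    S.le_topologicalClosure (Submodule.subset_span ⟨f, hf, rfl⟩)
  have hind : ∀ {K : Submodule ℂ (GroupCStar G)}, IsClosed (K : Set (GroupCStar G)) →
      (∀ f hf, ofL1 (G := G) f hf ∈ K) → ∀ x ∈ T, x ∈ K := fun {K} hK hm x hx =>
    S.topologicalClosure_minimal (Submodule.span_le.2 fun l ⟨f, hf, hl⟩ => hl ▸ hm f hf) hK hx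
  have hm1 : ∀ f hf f' hf', ofL1 (G := G) f hf * ofL1 f' hf' ∈ T := by
    intro f hf f' hf'
    have hc : Continuous fun g : G => (groupMultiplier g).fst (ofL1 f' hf') := by
      simp only [groupMultiplier_fst_ofL1]
      exact continuous_translate_ofL1 f' hf'
    rw [ofL1_mul_of_continuous f hf _ hc]
    exact integral_mem_of_isClosed hTc fun g =>
      T.smul_mem _ (by rw [groupMultiplier_fst_ofL1]; exact hgen _ _)
  have hm2 : ∀ x ∈ T, ∀ f' hf', x * ofL1 (G := G) f' hf' ∈ T := fun x hx f' hf' =>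
    hind (K := T.comap (LinearMap.mulRight ℂ (ofL1 f' hf')))
      (hTc.preimage (continuous_mul_const _)) (fun f hf => hm1 f hf f' hf') x hx
  have hm3 : ∀ x ∈ T, ∀ y ∈ T, x * y ∈ T := fun x hx y hy =>
    hind (K := T.comap (LinearMap.mulLeft ℂ x))
      (hTc.preimage (continuous_const_mul _)) (fun f hf => hm2 x hx f hf) y hy
  have hstar : ∀ x ∈ T, star x ∈ T := fun x hx => by
    have hcs : star x ∈ closure (S : Set (GroupCStar G)) := by
      refine map_mem_closure continuous_star hx fun y hy => ?_
      induction hy using Submodule.span_induction with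
      | mem l hl =>
        obtain ⟨f, hf, rfl⟩ := hl
        obtain ⟨f', hf', e⟩ := star_integratedFamily f hf
        exact Submodule.subset_span ⟨f', hf', GroupCStar.ext e⟩
      | zero => simp
      | add x y _ _ hx hy => rw [star_add]; exact add_mem hx hy
      | smul c x _ hx => rw [star_smul]; exact S.smul_mem _ hx
    exact hcs
  -- The adjoined algebra lives in the product, so closedness of `T` is transported along the closed
  -- embedding of `C⋆(G)`.
  have himg : IsClosed (GroupCStar.incl '' (T : Set (GroupCStar G))) :=
    ((isClosed_groupCStarSubalgebra (G := G)).isClosedEmbedding_subtypeVal.isClosedMap) _ hTc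
  intro l
  change l ∈ T
  have hl : GroupCStar.incl l ∈ (GroupCStar.incl '' (T : Set (GroupCStar G))) := by
    refine closure_minimal (s := ((NonUnitalStarAlgebra.adjoin ℂ (integratedFamilies G) :
      NonUnitalStarSubalgebra ℂ (RepProduct G)) : Set (RepProduct G))) (fun y hy => ?_) himg l.2
    induction hy using NonUnitalStarAlgebra.adjoin_induction with
    | mem x hx => obtain ⟨f, hf, rfl⟩ := hx; exact ⟨_, hgen f hf, rfl⟩
    | add x y _ _ hx hy =>
      obtain ⟨x, hx, rfl⟩ := hx
      obtain ⟨y, hy, rfl⟩ := hy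
      exact ⟨_, add_mem hx hy, rfl⟩
    | zero => exact ⟨0, zero_mem _, rfl⟩
    | mul x y _ _ hx hy =>
      obtain ⟨x, hx, rfl⟩ := hx
      obtain ⟨y, hy, rfl⟩ := hy
      exact ⟨_, hm3 x hx y hy, rfl⟩
    | smul r x _ hx =>
      obtain ⟨x, hx, rfl⟩ := hx
      exact ⟨_, T.smul_mem r hx, rfl⟩
    | star x _ hx =>
      obtain ⟨x, hx, rfl⟩ := hx
      exact ⟨_, hstar x hx, rfl⟩
  obtain ⟨l', hl', e⟩ := hl
  rwa [← GroupCStar.ext e]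

end GroupAlgebraLemmas

/-! ### Multiplication by characters on the group C⋆-algebra -/

section Twist

/-- Compact support suffices here, without continuity: inner regularity of Haar measure replaces the
indicator of a set of finite measure by that of a compact subset, and `L¹`-density of simple
functions does the rest. -/
theorem exists_compact_integral_sub_le {G : Type*} [Group G] [TopologicalSpace G]
    [IsTopologicalGroup G] [LocallyCompactSpace G] [MeasurableSpace G] [BorelSpace G]
    {f : G → ℂ} (hf : Integrable f (Measure.haar (G := G))) {ε : ℝ} (hε : 0 < ε) : ∃ k : G → ℂ, Integrable k (Measure.haar (G := G)) ∧
      (∃ K : Set G, IsCompact K ∧ ∀ g ∉ K, k g = 0) ∧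
      ∫ g, ‖f g - k g‖ ∂(Measure.haar (G := G)) ≤ ε := by
  have hind : ∀ (c : ℂ) ⦃s : Set G⦄, MeasurableSet s → Measure.haar s < ∞ → ∀ {ε : ℝ≥0∞}, ε ≠ 0 →
      ∃ k : G → ℂ, eLpNorm (k - s.indicator fun _ => c) 1 Measure.haar ≤ ε ∧
        Integrable k (Measure.haar (G := G)) ∧ ∃ K : Set G, IsCompact K ∧ ∀ g ∉ K, k g = 0 := by
    intro c s hs hμ ε hε
    obtain ⟨η, hη, h⟩ := exists_eLpNorm_indicator_le (p := 1) (μ := Measure.haar (G := G))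
      ENNReal.one_ne_top c hε
    obtain ⟨K, hKs, hK, hKc, hKμ⟩ := hs.exists_isCompact_isClosed_sdiff_lt hμ.ne
      (ENNReal.coe_pos.2 hη).ne'
    refine ⟨K.indicator fun _ => c, ?_, ?_, K, hK, fun g hg => Set.indicator_of_notMem hg _⟩
    · rw [← eLpNorm_neg, neg_sub, ← Set.indicator_sdiff hKs]
      exact h _ hKμ.le
    · exact (integrable_indicator_iff hKc.measurableSet).2
        (integrableOn_const ((measure_mono hKs).trans_lt hμ).ne)
  obtain ⟨k, hk, hki, hK⟩ := (memLp_one_iff_integrable.2 hf).induction_dense ENNReal.one_ne_top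
    (fun k : G → ℂ => Integrable k (Measure.haar (G := G)) ∧
      ∃ K : Set G, IsCompact K ∧ ∀ g ∉ K, k g = 0) hind
    (fun k l ⟨hk, K, hK, h1⟩ ⟨hl, L, hL, h2⟩ => ⟨hk.add hl, K ∪ L, hK.union hL, fun g hg => by
      rw [Set.mem_union, not_or] at hg
      rw [Pi.add_apply, h1 g hg.1, h2 g hg.2, add_zero]⟩)
    (fun k hk => hk.1.aestronglyMeasurable) (ENNReal.ofReal_pos.2 hε).ne'
  refine ⟨k, hki, hK, ?_⟩
  rw [eLpNorm_one_eq_lintegral_enorm] at hk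
  change ∫ g, ‖(f - k) g‖ ∂(Measure.haar (G := G)) ≤ ε
  rw [integral_norm_eq_lintegral_enorm (hf.sub hki).aestronglyMeasurable]
  exact ENNReal.toReal_le_of_le_ofReal hε.le hk

variable {G : Type u} [CommGroup G] [TopologicalSpace G]

theorem continuous_character (τ : PontryaginDual G) : Continuous fun g => ((τ g : Circle) : ℂ) :=
  continuous_induced_dom.comp (map_continuous τ)

/-- The unitary scalar `⟨g, τ⟩`. -/
def scalarUnitary (E : Type*) [CStarAlgebra E] (z : Circle) : unitary E :=
  ⟨algebraMap ℂ E z, by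
    rw [Unitary.mem_iff, ← algebraMap_star_comm, ← map_mul, ← map_mul]
    have h : star (z : ℂ) * z = 1 := by
      rw [Complex.star_def, ← Complex.normSq_eq_conj_mul_self, Circle.normSq_coe, Complex.ofReal_one]
    rw [mul_comm (z : ℂ), h, map_one]
    exact ⟨rfl, rfl⟩⟩

/-- The unitary representation `g ↦ ⟨g, τ⟩ U_g`. -/
def UnitaryRep.twist (τ : PontryaginDual G) (U : UnitaryRep G) : UnitaryRep G where
  space := U.space
  toHom :=
    { toFun := fun g => scalarUnitary (U.space →L[ℂ] U.space) (τ g) * U.toHom g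
      map_one' := Subtype.ext (by simp [scalarUnitary])
      map_mul' := fun g h => Subtype.ext (by
        simp only [scalarUnitary, map_mul, Submonoid.coe_mul, Circle.coe_mul,
          Algebra.algebraMap_eq_smul_one, smul_mul_assoc, one_mul, mul_smul_comm, smul_smul]) }
  continuous_apply := fun v => by
    have h : ∀ g, ((scalarUnitary (U.space →L[ℂ] U.space) (τ g) * U.toHom g :
        unitary (U.space →L[ℂ] U.space)) : U.space →L[ℂ] U.space) v =
        ((τ g : Circle) : ℂ) • (U.toHom g : U.space →L[ℂ] U.space) v := fun g => by
      simp [scalarUnitary, Algebra.algebraMap_eq_smul_one]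
    simp only [MonoidHom.coe_mk, OneHom.coe_mk, h]
    exact (continuous_character τ).smul (U.continuous_apply v)

theorem UnitaryRep.twist_toHom (τ : PontryaginDual G) (U : UnitaryRep G) (g : G) :
    (((U.twist τ).toHom g).1 : U.space →L[ℂ] U.space) =
      ((τ g : Circle) : ℂ) • (U.toHom g : U.space →L[ℂ] U.space) := by
  change algebraMap ℂ (U.space →L[ℂ] U.space) (τ g) * U.toHom g = _
  rw [Algebra.algebraMap_eq_smul_one, smul_mul_assoc, one_mul]

/-- The endomorphism of the product that permutes the coordinates by `U ↦ τU`. -/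
def RepProduct.twist (τ : PontryaginDual G) : RepProduct G →⋆ₙₐ[ℂ] RepProduct G where
  toFun x := RepProduct.mk (fun U => RepProduct.eval (U.twist τ) x) ‖x‖ fun U =>
    lp.norm_apply_le_norm ENNReal.top_ne_zero x (U.twist τ)
  map_smul' _ _ := rfl
  map_zero' := rfl
  map_add' _ _ := rfl
  map_mul' _ _ := rfl
  map_star' _ := rfl

variable [IsTopologicalGroup G] [T2Space G]
  [LocallyCompactSpace G] [MeasurableSpace G] [BorelSpace G]

theorem twist_integratedFamily (τ : PontryaginDual G) (f : G → ℂ)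
    (hf : Integrable f (Measure.haar (G := G))) :
    RepProduct.twist τ (integratedFamily f hf) =
      integratedFamily (fun g => ((τ g : Circle) : ℂ) * f g) (integrable_character_mul τ hf) := by
  refine RepProduct.ext fun U => ContinuousLinearMap.ext fun v => ?_
  change (∫ g, f g • (((U.twist τ).toHom g).1 : U.space →L[ℂ] U.space) v
    ∂(Measure.haar (G := G))) = ∫ g, (((τ g : Circle) : ℂ) * f g) •
      (U.toHom g : U.space →L[ℂ] U.space) v ∂(Measure.haar (G := G))
  refine integral_congr_ae (Eventually.of_forall fun g => ?_)
  refine (congrArg (fun T : U.space →L[ℂ] U.space => f g • T v)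
    (UnitaryRep.twist_toHom τ U g)).trans ?_
  change f g • ((τ g : Circle) : ℂ) • (U.toHom g : U.space →L[ℂ] U.space) v =
    (((τ g : Circle) : ℂ) * f g) • (U.toHom g : U.space →L[ℂ] U.space) v
  rw [smul_smul, mul_comm]

theorem twist_mem (τ : PontryaginDual G) (l : GroupCStar G) :
    RepProduct.twist τ (GroupCStar.incl l) ∈ groupCStarSubalgebra G := by
  have hcont : Continuous (RepProduct.twist (G := G) τ) :=
    AddMonoidHomClass.continuous_of_bound _ 1 fun l => by
      simpa using NonUnitalStarAlgHom.norm_apply_le (RepProduct.twist (G := G) τ) l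
  have hic : Continuous (GroupCStar.incl (G := G)) := continuous_subtype_val
  have hcl : IsClosed {l : GroupCStar G |
      RepProduct.twist τ (GroupCStar.incl l) ∈ groupCStarSubalgebra G} :=
    (isClosed_groupCStarSubalgebra (G := G)).preimage (hcont.comp hic)
  refine closure_minimal (fun x hx => ?_) hcl (dense_span_ofL1 G l)
  change RepProduct.twist τ (GroupCStar.incl x) ∈ groupCStarSubalgebra G
  induction hx using Submodule.span_induction with
  | mem x hx =>
    obtain ⟨f, hf, rfl⟩ := hx
    change RepProduct.twist τ (integratedFamily f hf) ∈ _
    rw [twist_integratedFamily]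
    exact integratedFamily_mem _ _
  | zero => simp
  | add x y _ _ hx hy => simpa only [map_add] using add_mem hx hy
  | smul c x _ hx => simpa only [map_smul] using SMulMemClass.smul_mem c hx

/-- The endomorphism of `C⋆(G)` that extends `f ↦ τf`, `f ∈ L¹(G)`. -/
def GroupCStar.twist (τ : PontryaginDual G) : GroupCStar G →⋆ₙₐ[ℂ] GroupCStar G where
  toFun l := ⟨RepProduct.twist τ (GroupCStar.incl l), twist_mem τ l⟩
  map_smul' _ _ := rfl
  map_zero' := rfl
  map_add' _ _ := rfl
  map_mul' _ _ := rfl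
  map_star' _ := rfl

theorem UnitaryRep.integratedRep_twist (τ : PontryaginDual G) (U : UnitaryRep G)
    (l : GroupCStar G) :
    U.integratedRep (GroupCStar.twist τ l) = (U.twist τ).integratedRep l := rfl

theorem twist_ofL1 (τ : PontryaginDual G) (f : G → ℂ)
    (hf : Integrable f (Measure.haar (G := G))) :
    GroupCStar.twist τ (ofL1 f hf) =
      ofL1 (fun g => ((τ g : Circle) : ℂ) * f g) (integrable_character_mul τ hf) :=
  GroupCStar.ext (twist_integratedFamily τ f hf)

theorem GroupCStar.ext_integratedRep {x y : GroupCStar G}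
    (h : ∀ U : UnitaryRep G, U.integratedRep x = U.integratedRep y) : x = y :=
  GroupCStar.ext (RepProduct.ext h)

theorem integratedRep_groupMultiplier_fst (U : UnitaryRep G) (g : G) (l : GroupCStar G) :
    U.integratedRep ((groupMultiplier g).fst l) =
      (U.toHom g : U.space →L[ℂ] U.space) * U.integratedRep l := rfl

/-- The source of the relation `dual_lam` between `λ` and the dual action. -/
theorem twist_groupMultiplier_fst (τ : PontryaginDual G) (g : G) (l : GroupCStar G) :
    GroupCStar.twist τ ((groupMultiplier g).fst l) =
      ((τ g : Circle) : ℂ) • (groupMultiplier g).fst (GroupCStar.twist τ l) :=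
  GroupCStar.ext_integratedRep fun U => by
    rw [map_smul, integratedRep_groupMultiplier_fst, UnitaryRep.integratedRep_twist,
      ← smul_mul_assoc]
    exact congrArg (fun T : U.space →L[ℂ] U.space => T * U.integratedRep (GroupCStar.twist τ l))
      (UnitaryRep.twist_toHom τ U g)

theorem GroupCStar.hom_ext {E : Type*} [NonUnitalCStarAlgebra E] {φ ψ : GroupCStar G →⋆ₙₐ[ℂ] E}
    (h : ∀ (f : G → ℂ) (hf : Integrable f (Measure.haar (G := G))),
      φ (ofL1 f hf) = ψ (ofL1 f hf)) (l : GroupCStar G) : φ l = ψ l := by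
  have hcont : ∀ χ : GroupCStar G →⋆ₙₐ[ℂ] E, Continuous χ := fun χ =>
    AddMonoidHomClass.continuous_of_bound χ 1 fun l => by
      simpa using NonUnitalStarAlgHom.norm_apply_le χ l
  refine closure_minimal (t := {l | φ l = ψ l}) (fun x hx => ?_)
    (isClosed_eq (hcont φ) (hcont ψ)) (dense_span_ofL1 G l)
  change φ x = ψ x
  induction hx using Submodule.span_induction with
  | mem x hx => obtain ⟨f, hf, rfl⟩ := hx; exact h f hf
  | zero => simp
  | add x y _ _ hx hy => rw [map_add, map_add, hx, hy]
  | smul c x _ hx => rw [map_smul, map_smul, hx]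

theorem twist_mul (τ σ : PontryaginDual G) (l : GroupCStar G) :
    GroupCStar.twist (τ * σ) l = GroupCStar.twist τ (GroupCStar.twist σ l) := by
  refine GroupCStar.hom_ext (ψ := (GroupCStar.twist τ).comp (GroupCStar.twist σ))
    (fun f hf => ?_) l
  rw [NonUnitalStarAlgHom.comp_apply, twist_ofL1, twist_ofL1, twist_ofL1]
  congr 1
  funext g
  rw [← mul_assoc]
  rfl

theorem twist_one (l : GroupCStar G) : GroupCStar.twist 1 l = l := by
  refine GroupCStar.hom_ext (ψ := NonUnitalStarAlgHom.id ℂ _) (fun f hf => ?_) l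
  rw [twist_ofL1]
  change _ = ofL1 f hf
  congr 1
  funext g
  simp

/-- Convergence in the dual group is uniform convergence on compact sets. This handles functions `k`
that vanish off a compact set, and contractivity of the twists makes the approximation of `f` by
such `k` uniform in `τ`. -/
theorem continuous_twist_ofL1 (f : G → ℂ) (hf : Integrable f (Measure.haar (G := G))) :
    Continuous fun τ : PontryaginDual G => GroupCStar.twist τ (ofL1 f hf) := by
  have happ : ∀ ε > 0, ∃ (k : G → ℂ) (hk : Integrable k (Measure.haar (G := G))),
      ‖ofL1 f hf - ofL1 k hk‖ < ε ∧
        Continuous fun τ : PontryaginDual G => GroupCStar.twist τ (ofL1 k hk) := by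
    intro ε hε
    obtain ⟨k, hki, ⟨K, hK, hk0⟩, hkε⟩ := exists_compact_integral_sub_le hf (half_pos hε)
    refine ⟨k, hki, (norm_ofL1_sub_le _ _ _ _).trans_lt (by linarith), ?_⟩
    refine continuous_iff_continuousAt.2 fun τ₀ => Metric.tendsto_nhds.2 fun δ hδ => ?_
    -- If `τ` is within `δ / (N + 1)` of `τ₀` on `K`, the `L¹`-distance is at most `δN / (N + 1) <
    -- δ`; the `+ 1` covers `N = 0`.
    set N := ∫ g, ‖k g‖ ∂(Measure.haar (G := G)) with hN
    have hN0 : 0 ≤ N := integral_nonneg fun _ => norm_nonneg _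
    -- Evaluation is jointly continuous because `G` is locally compact; compactness of `K` then
    -- makes the estimate uniform on `K`.
    have hcont : Continuous fun p : PontryaginDual G × G =>
        ‖((p.1 p.2 : Circle) : ℂ) - ((τ₀ p.2 : Circle) : ℂ)‖ :=
      ((continuous_induced_dom.comp (continuous_eval (F := ContinuousMonoidHom G Circle))).sub
        ((continuous_character τ₀).comp continuous_snd)).norm
    have hev : ∀ᶠ τ : PontryaginDual G in 𝓝 τ₀, ∀ g ∈ K,
        ‖((τ g : Circle) : ℂ) - ((τ₀ g : Circle) : ℂ)‖ < δ / (N + 1) := by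
      refine hK.eventually_forall_of_forall_eventually fun g _ => ?_
      refine (hcont.tendsto (τ₀, g)).eventually (gt_mem_nhds ?_)
      simp only [sub_self, norm_zero]
      positivity
    filter_upwards [hev] with τ hτ
    rw [dist_eq_norm, twist_ofL1, twist_ofL1]
    refine (norm_ofL1_sub_le _ _ _ _).trans_lt ?_
    refine (integral_mono_of_nonneg (g := fun g => δ / (N + 1) * ‖k g‖)
      (Eventually.of_forall fun _ => norm_nonneg _) (hki.norm.const_mul _)
      (Eventually.of_forall fun g => ?_)).trans_lt ?_
    · by_cases hg : g ∈ K
      · simp only [← sub_mul, norm_mul]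
        exact mul_le_mul_of_nonneg_right (hτ g hg).le (norm_nonneg _)
      · simp [hk0 g hg]
    · rw [integral_const_mul, ← hN, div_mul_eq_mul_div, div_lt_iff₀ (by positivity)]
      nlinarith
  refine continuous_of_uniform_approx_of_continuous fun u hu => ?_
  obtain ⟨ε, hε, hεu⟩ := Metric.mem_uniformity_dist.1 hu
  obtain ⟨k, hk, hlt, hc⟩ := happ ε hε
  refine ⟨_, hc, fun τ => hεu ?_⟩
  rw [dist_eq_norm, ← map_sub]
  exact (NonUnitalStarAlgHom.norm_apply_le (GroupCStar.twist τ) _).trans_lt hlt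

theorem continuous_twist (l : GroupCStar G) :
    Continuous fun τ : PontryaginDual G => GroupCStar.twist τ l :=
  continuous_apply_of_dense
    (fun τ : PontryaginDual G => (GroupCStar.twist τ : GroupCStar G →ₗ[ℂ] GroupCStar G))
    (fun τ => NonUnitalStarAlgHom.norm_apply_le (GroupCStar.twist τ)) (dense_span_ofL1 G)
    (by rintro _ ⟨f, hf, rfl⟩; exact continuous_twist_ofL1 f hf) l

theorem continuous_groupMultiplier_fst (l : GroupCStar G) :
    Continuous fun g : G => (groupMultiplier g).fst l :=
  continuous_apply_of_dense
    (fun g : G => ((groupMultiplier g).fst : GroupCStar G →ₗ[ℂ] GroupCStar G))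
    norm_groupMultiplier_fst_le (dense_span_ofL1 G)
    (by
      rintro _ ⟨f, hf, rfl⟩
      simp only [ContinuousLinearMap.coe_coe, groupMultiplier_fst_ofL1]
      exact continuous_translate_ofL1 f hf) l

theorem ofL1_mul (f : G → ℂ) (hf : Integrable f (Measure.haar (G := G))) (l : GroupCStar G) :
    ofL1 f hf * l = ∫ g, f g • (groupMultiplier g).fst l ∂(Measure.haar (G := G)) :=
  ofL1_mul_of_continuous f hf l (continuous_groupMultiplier_fst l)

end Twist

/-! ### Nondegenerate representations, their extension to multipliers, and graphs -/

section Representations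

/-- `ρ : C → B(H)` is nondegenerate: the linear span of `ρ(C)H` is dense in `H`. -/
def IsNondegenerateRep {C H : Type*} [NonUnitalCStarAlgebra C] [NormedAddCommGroup H]
    [InnerProductSpace ℂ H] [CompleteSpace H] (ρ : C →⋆ₙₐ[ℂ] (H →L[ℂ] H)) : Prop :=
  Dense (Submodule.span ℂ {w : H | ∃ (c : C) (v : H), w = ρ c v} : Set H)

section Positive

open scoped ComplexOrder

/-- Hahn–Banach: the positive cone is closed and convex and does not contain `-a`, so a real
functional is nonnegative on the cone and negative at `-a`. Composed with the real part and
complexified, it becomes the desired positive functional. -/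
theorem exists_positive_functional {C : Type*} [NonUnitalCStarAlgebra C] [PartialOrder C]
    [StarOrderedRing C] {a : C} (ha : 0 ≤ a) (ha0 : a ≠ 0) :
    ∃ f : C →ₚ[ℂ] ℂ, f a ≠ 0 := by
  let K : ProperCone ℝ C :=
    { carrier := {x | 0 ≤ x}
      add_mem' := fun hx hy => add_nonneg hx hy
      zero_mem' := le_refl (0 : C)
      smul_mem' := fun c x hx => smul_nonneg c.2 hx
      isClosed' := CStarAlgebra.isClosed_nonneg }
  have hK : -a ∉ K := fun h => ha0 (le_antisymm (neg_nonneg.1 h) ha)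
  obtain ⟨φ, hφ, hφa⟩ := K.hyperplane_separation_point hK
  let ψ : Module.Dual ℝ C := φ.toLinearMap ∘ₗ
    ((selfAdjoint.submodule ℝ C).subtype ∘ₗ (realPart : C →ₗ[ℝ] selfAdjoint C))
  -- A positive `x` is self-adjoint, so `Re x = x` and `Re (ix) = 0`: the complexification agrees
  -- with `φ` on the cone.
  have hsa : ∀ x : C, 0 ≤ x → ψ.extendRCLike (𝕜 := ℂ) x = ((φ x : ℝ) : ℂ) := by
    intro x hx
    have hx' : IsSelfAdjoint x := IsSelfAdjoint.of_nonneg hx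
    have h1 : ψ x = φ x := congrArg φ hx'.coe_realPart
    have h2 : ψ ((Complex.I : ℂ) • x) = 0 := by
      change φ ((realPart ((Complex.I : ℂ) • x) : selfAdjoint C) : C) = 0
      rw [realPart_I_smul, hx'.imaginaryPart]
      simp
    rw [Module.Dual.extendRCLike_apply, h1]
    have h2' : ψ ((RCLike.I : ℂ) • x) = 0 := h2
    rw [h2']
    simp
  refine ⟨PositiveLinearMap.mk₀ (ψ.extendRCLike (𝕜 := ℂ)) fun x hx => ?_, ?_⟩
  · rw [hsa x hx]
    exact_mod_cast hφ x hx
  · change ψ.extendRCLike (𝕜 := ℂ) a ≠ 0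
    rw [hsa a ha]
    rw [map_neg] at hφa
    exact_mod_cast (neg_neg_iff_pos.1 hφa).ne'

/-- Without a unit there is no obvious cyclic vector; instead the classes of `ux` tend to the class
of `x` along an approximate unit `u`. -/
theorem isNondegenerateRep_gns {C : Type*} [NonUnitalCStarAlgebra C] [PartialOrder C]
    [StarOrderedRing C] (f : C →ₚ[ℂ] ℂ) : IsNondegenerateRep f.gnsNonUnitalStarAlgHom := by
  set S := Submodule.span ℂ {w : f.GNS | ∃ (c : C) (v : f.GNS), w = f.gnsNonUnitalStarAlgHom c v}
    with hS
  have hF := CStarAlgebra.increasingApproximateUnit C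
  set F := CStarAlgebra.approximateUnit C
  have hcoe : ∀ x : f.PreGNS, (x : f.GNS) ∈ closure (S : Set f.GNS) := by
    intro x
    -- Boundedness of `f` gives `‖[z]‖² = f(z*z) ≤ M‖z‖²`, so norm convergence in `C` implies
    -- convergence in the GNS space.
    obtain ⟨M, hM⟩ := f.exists_norm_apply_le
    have hb : ∀ z : C, ‖f.toPreGNS z‖ ^ 2 ≤ M * ‖z‖ ^ 2 := by
      intro z
      have h1 : ‖f.toPreGNS z‖ ^ 2 = ‖f (star z * z)‖ := by
        have := f.preGNS_norm_sq (f.toPreGNS z)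
        rw [f.ofPreGNS_toPreGNS] at this
        rw [← this]
        simp
      rw [h1, sq ‖z‖, ← CStarRing.norm_star_mul_self]
      exact hM _
    have ht : Tendsto (fun u : C => f.toPreGNS (u * f.ofPreGNS x)) F (𝓝 x) := by
      rw [tendsto_iff_norm_sub_tendsto_zero]
      have h2 := tendsto_iff_norm_sub_tendsto_zero.1 (hF.tendsto_mul_right (f.ofPreGNS x))
      have h3 : Tendsto (fun u : C => √(M * ‖u * f.ofPreGNS x - f.ofPreGNS x‖ ^ 2)) F (𝓝 0) := by
        simpa using ((h2.pow 2).const_mul (M : ℝ)).sqrt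
      refine squeeze_zero (fun _ => norm_nonneg _) (fun u => Real.le_sqrt_of_sq_le ?_) h3
      have := hb (u * f.ofPreGNS x - f.ofPreGNS x)
      rwa [map_sub, f.toPreGNS_ofPreGNS] at this
    refine mem_closure_of_tendsto
      (((UniformSpace.Completion.continuous_coe f.PreGNS).tendsto x).comp ht)
      (Eventually.of_forall fun u => Submodule.subset_span ⟨u, x, ?_⟩)
    rw [f.gnsNonUnitalStarAlgHom_apply_coe]
    rfl
  intro v
  refine closure_minimal (s := Set.range ((↑) : f.PreGNS → f.GNS)) ?_ isClosed_closure
    (UniformSpace.Completion.denseRange_coe v)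
  rintro _ ⟨x, rfl⟩
  exact hcoe x

/-- The GNS operator of `y` sends the class of `y*` to that of `yy*`, whose squared norm is
`f((yy*)*(yy*))`; `f` is chosen not to vanish there. -/
theorem exists_nondegenerate_rep {C : Type u} [NonUnitalCStarAlgebra C] {y : C} (hy : y ≠ 0) :
    ∃ (H : Type u) (_ : NormedAddCommGroup H) (_ : InnerProductSpace ℂ H) (_ : CompleteSpace H)
      (ρ : C →⋆ₙₐ[ℂ] (H →L[ℂ] H)), IsNondegenerateRep ρ ∧ ρ y ≠ 0 := by
  let _ := CStarAlgebra.spectralOrder C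
  have _ := CStarAlgebra.spectralOrderedRing C
  have h1 : y * star y ≠ 0 := fun h => hy (CStarRing.mul_star_self_eq_zero_iff _ |>.1 h)
  have h2 : star (y * star y) * (y * star y) ≠ 0 := fun h =>
    h1 (CStarRing.star_mul_self_eq_zero_iff _ |>.1 h)
  obtain ⟨f, hf⟩ := exists_positive_functional (star_mul_self_nonneg (y * star y)) h2
  refine ⟨f.GNS, inferInstance, inferInstance, inferInstance, f.gnsNonUnitalStarAlgHom,
    isNondegenerateRep_gns f, fun h => hf ?_⟩
  have h3 : f.gnsNonUnitalStarAlgHom y (f.toPreGNS (star y) : f.GNS) = 0 := by rw [h]; rfl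
  rw [f.gnsNonUnitalStarAlgHom_apply_coe] at h3
  have h4 : ‖f.toPreGNS (y * star y)‖ = 0 := by
    rw [← UniformSpace.Completion.norm_coe]
    exact norm_eq_zero.2 h3
  have h5 := f.preGNS_norm_sq (f.toPreGNS (y * star y))
  rw [h4, f.ofPreGNS_toPreGNS] at h5
  rw [← h5]
  simp

end Positive

section Extension

variable {C H : Type*} [NonUnitalCStarAlgebra C] [NormedAddCommGroup H]
  [InnerProductSpace ℂ H] [CompleteSpace H] {ρ : C →⋆ₙₐ[ℂ] (H →L[ℂ] H)}

theorem continuous_starHom {D : Type*} [NonUnitalCStarAlgebra D] (φ : C →⋆ₙₐ[ℂ] D) :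
    Continuous φ :=
  AddMonoidHomClass.continuous_of_bound φ 1 fun l => by
    simpa using NonUnitalStarAlgHom.norm_apply_le φ l

theorem ext_of_nondegenerateRep (hρ : IsNondegenerateRep ρ) {S T : H →L[ℂ] H}
    (h : ∀ c, S * ρ c = T * ρ c) : S = T := by
  refine ContinuousLinearMap.ext_on hρ ?_
  rintro _ ⟨c, v, rfl⟩
  exact congrArg (fun Z : H →L[ℂ] H => Z v) (h c)

/-- `T` is the strong limit of `ρ(mu)` along an approximate unit `u`: these operators are eventually
bounded by `‖m‖` and converge on the total set of vectors `ρ(c)v`. -/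
theorem exists_repExtension_aux (hρ : IsNondegenerateRep ρ) (m : 𝓜(ℂ, C)) :
    ∃ T : H →L[ℂ] H, ∀ c, T * ρ c = ρ (m.fst c) := by
  let _ := CStarAlgebra.spectralOrder C
  have _ := CStarAlgebra.spectralOrderedRing C
  have hF := CStarAlgebra.increasingApproximateUnit C
  set F := CStarAlgebra.approximateUnit C
  have hb : ∀ᶠ u in F, ‖ρ (m.fst u)‖ ≤ ‖m‖ := by
    filter_upwards [hF.eventually_norm] with u hu
    refine (NonUnitalStarAlgHom.norm_apply_le ρ _).trans ?_
    simpa using m.fst.le_of_opNorm_le_of_le (DoubleCentralizer.norm_fst m).le hu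
  have hleft : ∀ c, Tendsto (fun u => ρ (m.fst u) * ρ c) F (𝓝 (ρ (m.fst c))) := by
    intro c
    have h1 : ∀ u, ρ (m.fst u) * ρ c = ρ (m.fst (u * c)) := fun u => by
      rw [← map_mul, fst_mul_right]
    simp only [h1]
    exact (((continuous_starHom ρ).comp m.fst.continuous).tendsto _).comp (hF.tendsto_mul_right c)
  have happ : ∀ (c : C) (v : H),
      Tendsto (fun u => (ρ (m.fst u) * ρ c) v) F (𝓝 (ρ (m.fst c) v)) := fun c v =>
    ((ContinuousLinearMap.apply ℂ H v).continuous.tendsto _).comp (hleft c)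
  obtain ⟨T, hT⟩ := exists_limit (F := F) (fun u => ρ (m.fst u)) hb hρ (by
      rintro _ ⟨c, v, rfl⟩
      exact ⟨_, happ c v⟩)
  exact ⟨T, fun c => ContinuousLinearMap.ext fun v => tendsto_nhds_unique (hT (ρ c v)) (happ c v)⟩

/-- A nondegenerate representation of `C` extends to `M(C)`. -/
theorem exists_repExtension (hρ : IsNondegenerateRep ρ) :
    ∃ ψ : 𝓜(ℂ, C) →⋆ₐ[ℂ] (H →L[ℂ] H), ∀ m c, ψ m * ρ c = ρ (m.fst c) := by
  choose T hT using exists_repExtension_aux hρ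
  have huniq : ∀ m S, (∀ c, S * ρ c = ρ (m.fst c)) → S = T m := fun m S hS =>
    ext_of_nondegenerateRep hρ fun c => (hS c).trans (hT m c).symm
  refine ⟨
    { toFun := T
      map_one' := (huniq _ _ fun c => by rw [one_mul]; rfl).symm
      map_mul' := fun m n => (huniq _ _ fun c => by rw [mul_assoc, hT, hT]; rfl).symm
      map_zero' := (huniq _ _ fun c => by rw [zero_mul]; exact (map_zero ρ).symm).symm
      map_add' := fun m n => (huniq _ _ fun c => by
        rw [add_mul, hT, hT, ← map_add]; rfl).symm
      commutes' := fun z => (huniq _ _ fun c => by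
        rw [Algebra.algebraMap_eq_smul_one, smul_mul_assoc, one_mul, ← map_smul,
          Algebra.algebraMap_eq_smul_one]; rfl).symm
      map_star' := fun m => (huniq _ _ fun c => by
        have hz : ∀ c', ρ c' * (star (T m) * ρ c) = ρ c' * ρ ((star m).fst c) := by
          intro c'
          rw [← mul_assoc, ← map_mul]
          have h1 : ρ c' * star (T m) = star (ρ (m.fst (star c'))) := by
            rw [← hT, star_mul, ← map_star, star_star]
          rw [h1, ← map_star, ← map_mul, ← (star m).central]
          rfl
        -- Nondegeneracy tests an operator against `ρ(c')` on the right, whereas `hz` has it on the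
        -- left; hence the passage to adjoints.
        refine sub_eq_zero.1 (star_eq_zero.1 (ext_of_nondegenerateRep hρ fun c' => ?_))
        rw [zero_mul, ← star_eq_zero, star_mul, star_star, ← map_star, mul_sub, hz,
          sub_self]).symm }, hT⟩

end Extension

section GraphHom

/-- A closed relation that generates the graph of a `⋆`-endomorphism: it suffices to check the
relation in sufficiently many representations. -/
theorem exists_starHom_of_generators {C : Type u} [NonUnitalCStarAlgebra C] (s : Set (C × C))
    (hs : (NonUnitalStarAlgebra.adjoin ℂ (Prod.fst '' s)).topologicalClosure = ⊤)
    (h : ∀ (H : Type u) (_ : NormedAddCommGroup H) (_ : InnerProductSpace ℂ H)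
      (_ : CompleteSpace H) (ρ : C →⋆ₙₐ[ℂ] (H →L[ℂ] H)), IsNondegenerateRep ρ →
      ∃ ρ' : C →⋆ₙₐ[ℂ] (H →L[ℂ] H), ∀ p ∈ s, ρ' p.1 = ρ p.2) :
    ∃ δ : C →⋆ₙₐ[ℂ] C, ∀ p ∈ s, δ p.1 = p.2 := by
  set K : NonUnitalStarSubalgebra ℂ (C × C) :=
    (NonUnitalStarAlgebra.adjoin ℂ s).topologicalClosure with hK
  have hKc : IsClosed (K : Set (C × C)) := NonUnitalStarSubalgebra.isClosed_topologicalClosure _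
  have hsK : ∀ p ∈ s, p ∈ K := fun p hp =>
    NonUnitalStarSubalgebra.le_topologicalClosure _ (NonUnitalStarAlgebra.subset_adjoin ℂ _ hp)
  let π₁ : K →⋆ₙₐ[ℂ] C :=
    (NonUnitalStarAlgHom.fst ℂ C C).comp (NonUnitalStarSubalgebraClass.subtype K)
  let π₂ : K →⋆ₙₐ[ℂ] C :=
    (NonUnitalStarAlgHom.snd ℂ C C).comp (NonUnitalStarSubalgebraClass.subtype K)
  have hrep : ∀ (H : Type u) (_ : NormedAddCommGroup H) (_ : InnerProductSpace ℂ H)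
      (_ : CompleteSpace H) (ρ ρ' : C →⋆ₙₐ[ℂ] (H →L[ℂ] H)), (∀ p ∈ s, ρ' p.1 = ρ p.2) →
      ∀ p ∈ K, ρ' p.1 = ρ p.2 := by
    intro H _ _ _ ρ ρ' hρ p hp
    refine closure_minimal (s := (NonUnitalStarAlgebra.adjoin ℂ s : Set (C × C)))
      (t := {p : C × C | ρ' p.1 = ρ p.2}) (fun x hx => ?_)
      (isClosed_eq ((continuous_starHom ρ').comp continuous_fst)
        ((continuous_starHom ρ).comp continuous_snd)) hp
    change ρ' x.1 = ρ x.2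
    induction hx using NonUnitalStarAlgebra.adjoin_induction with
    | mem x hx => exact hρ x hx
    | add x y _ _ hx hy => simp [hx, hy]
    | zero => simp
    | mul x y _ _ hx hy => simp [hx, hy]
    | smul r x _ hx => simp [hx]
    | star x _ hx => simp [map_star, hx]
  -- `K` is a graph: for `(0, y) ∈ K` with `y ≠ 0`, a representation `ρ` not killing `y` and its
  -- companion `ρ'` give `ρ(y) = ρ'(0) = 0`.
  have hinj : Function.Injective π₁ := by
    rw [injective_iff_map_eq_zero]
    rintro ⟨p, hp⟩ h0
    have h1 : p.1 = 0 := h0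
    by_contra hne
    have h2 : p.2 ≠ 0 := fun h2 => hne (Subtype.ext (Prod.ext h1 h2))
    obtain ⟨H, i1, i2, i3, ρ, hρ, hy⟩ := exists_nondegenerate_rep h2
    obtain ⟨ρ', hρ'⟩ := h H i1 i2 i3 ρ hρ
    have := hrep H i1 i2 i3 ρ ρ' hρ' p hp
    rw [h1, map_zero] at this
    exact hy this.symm
  have hiso : Isometry π₁ := NonUnitalStarAlgHom.isometry π₁ hinj
  -- An injective `⋆`-homomorphism is isometric, so its range is closed; it contains the generators.
  have hsurj : Function.Surjective π₁ := by
    refine dense_adjoin_induction hs (p := fun x => ∃ k, π₁ k = x) ?_ ?_ ⟨0, map_zero _⟩ ?_ ?_ ?_ ?_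
    · exact hiso.isClosedEmbedding.isClosed_range
    · rintro _ ⟨p, hp, rfl⟩
      exact ⟨⟨p, hsK p hp⟩, rfl⟩
    · rintro _ _ ⟨x, rfl⟩ ⟨y, rfl⟩; exact ⟨x + y, map_add _ _ _⟩
    · rintro _ _ ⟨x, rfl⟩ ⟨y, rfl⟩; exact ⟨x * y, map_mul _ _ _⟩
    · rintro c _ ⟨x, rfl⟩; exact ⟨c • x, map_smul _ _ _⟩
    · rintro _ ⟨x, rfl⟩; exact ⟨star x, map_star _ _⟩
  let e : K ≃⋆ₐ[ℂ] C := StarAlgEquiv.ofBijective π₁ ⟨hinj, hsurj⟩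
  refine ⟨π₂.comp (e.symm : C →⋆ₙₐ[ℂ] K), fun p hp => ?_⟩
  have : e.symm p.1 = ⟨p, hsK p hp⟩ := e.symm_apply_eq.2 rfl
  change π₂ (e.symm p.1) = p.2
  rw [this]
  rfl

end GraphHom

end Representations

/-! ### Structure of a crossed product host -/

section HostLemmas

theorem dense_span_of_dense {E : Type*} [NormedAddCommGroup E] [NormedSpace ℂ E] {D D' : Set E}
    (hD : Dense (Submodule.span ℂ D : Set E))
    (h : ∀ d ∈ D, d ∈ (Submodule.span ℂ D').topologicalClosure) :
    Dense (Submodule.span ℂ D' : Set E) := fun v =>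
  (Submodule.span ℂ D).topologicalClosure_minimal (Submodule.span_le.2 h)
    (Submodule.isClosed_topologicalClosure _) (hD v)

theorem map_mem_closure_span {E F : Type*} [NormedAddCommGroup E] [NormedSpace ℂ E]
    [NormedAddCommGroup F] [NormedSpace ℂ F] (T : E →L[ℂ] F) {D : Set E} {N : Submodule ℂ F}
    (hN : IsClosed (N : Set F)) (h : ∀ d ∈ D, T d ∈ N) {v : E}
    (hv : v ∈ (Submodule.span ℂ D).topologicalClosure) : T v ∈ N :=
  Submodule.topologicalClosure_minimal (t := N.comap (T : E →ₗ[ℂ] F)) _ (Submodule.span_le.2 h)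
    (hN.preimage T.continuous) hv

section Coe

variable {C : Type*} [NonUnitalCStarAlgebra C]

theorem coe_injective : Function.Injective fun c : C => (c : 𝓜(ℂ, C)) := fun x y h => by
  have h1 : ∀ z, x * z = y * z := fun z => congrArg (fun m : 𝓜(ℂ, C) => m.fst z) h
  have h2 : (x - y) * star (x - y) = 0 := by rw [sub_mul, h1, sub_self]
  exact sub_eq_zero.1 (CStarRing.mul_star_self_eq_zero_iff _ |>.1 h2)

theorem norm_coe_multiplier (c : C) : ‖(c : 𝓜(ℂ, C))‖ = ‖c‖ :=
  NonUnitalStarAlgHom.norm_map (DoubleCentralizer.coeHom : C →⋆ₙₐ[ℂ] 𝓜(ℂ, C)) coe_injective c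

theorem star_coe_multiplier (c : C) : ((star c : C) : 𝓜(ℂ, C)) = star (c : 𝓜(ℂ, C)) :=
  map_star (DoubleCentralizer.coeHom : C →⋆ₙₐ[ℂ] 𝓜(ℂ, C)) c

theorem extendAut_eq {θ : C ≃⋆ₐ[ℂ] C} {m n : 𝓜(ℂ, C)} (h : ∀ y, θ (m.fst y) = n.fst (θ y)) :
    extendAut θ m = n :=
  multiplier_ext fun y => by
    change θ (m.fst (θ.symm y)) = n.fst y
    rw [h, θ.apply_symm_apply]

end Coe

variable {G A C : Type u} [CommGroup G] [TopologicalSpace G] [IsTopologicalGroup G] [T2Space G]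
  [LocallyCompactSpace G] [MeasurableSpace G] [BorelSpace G]
  [NonUnitalCStarAlgebra A] [NonUnitalCStarAlgebra C]

section Extension

variable {ηL : GroupCStar G →⋆ₙₐ[ℂ] 𝓜(ℂ, C)} (hL : IsNondegenerate ηL)

/-- The homomorphism of unitary groups induced by a unital `⋆`-homomorphism. -/
def unitaryHom {D E : Type*} [CStarAlgebra D] [CStarAlgebra E] (ψ : D →⋆ₐ[ℂ] E) :
    unitary D →* unitary E where
  toFun u := ⟨ψ u, by
    rw [Unitary.mem_iff, ← map_star, ← map_mul, ← map_mul, Unitary.star_mul_self_of_mem u.2,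
      Unitary.mul_star_self_of_mem u.2, map_one]
    exact ⟨rfl, rfl⟩⟩
  map_one' := Subtype.ext (map_one ψ)
  map_mul' u v := Subtype.ext (map_mul ψ (u : D) v)

/-- The homomorphism `g ↦ λ_g` of `G` into the unitary group of `M(C)`. -/
def hostLam : G →* unitary 𝓜(ℂ, C) :=
  (unitaryHom (multiplierExtension hL)).comp canonicalHom

theorem hostLam_coe (g : G) : (hostLam hL g : 𝓜(ℂ, C)) =
    multiplierExtension hL (canonicalHom g : 𝓜(ℂ, GroupCStar G)) := rfl

theorem hostLam_mul (g : G) (l : GroupCStar G) :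
    (hostLam hL g : 𝓜(ℂ, C)) * ηL l = ηL ((groupMultiplier g).fst l) := by
  rw [hostLam_coe, ← multiplierExtension_coe hL l, ← map_mul, coe_mul_multiplier,
    multiplierExtension_coe]
  rfl

theorem norm_hostLam_fst_le (g : G) (y : C) : ‖(hostLam hL g : 𝓜(ℂ, C)).fst y‖ ≤ ‖y‖ := by
  simpa using (hostLam hL g : 𝓜(ℂ, C)).fst.le_of_opNorm_le
    ((DoubleCentralizer.norm_fst _).le.trans (norm_unitary_le (hostLam hL g))) y

theorem continuous_hostLam_fst (y : C) :
    Continuous fun g => (hostLam hL g : 𝓜(ℂ, C)).fst y := by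
  refine continuous_apply_of_dense
    (fun g => ((hostLam hL g : 𝓜(ℂ, C)).fst : C →ₗ[ℂ] C)) (norm_hostLam_fst_le hL) hL ?_ y
  rintro _ ⟨l, c, rfl⟩
  have h : ∀ g, (hostLam hL g : 𝓜(ℂ, C)).fst ((ηL l).fst c) =
      (ηL ((groupMultiplier g).fst l)).fst c := fun g =>
    congrArg (fun m : 𝓜(ℂ, C) => m.fst c) (hostLam_mul hL g l)
  simp only [ContinuousLinearMap.coe_coe, h]
  have hc : Continuous fun g => ηL ((groupMultiplier g).fst l) :=
    (continuous_starHom ηL).comp (continuous_groupMultiplier_fst l)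
  exact continuous_iff_continuousAt.2 fun g => tendsto_fst_apply (hc.tendsto g) c

/-- The continuous linear map `l ↦ φ(l)c`. -/
def applyCLM {L : Type*} [NonUnitalCStarAlgebra L] (φ : L →⋆ₙₐ[ℂ] 𝓜(ℂ, C)) (c : C) : L →L[ℂ] C where
  toFun l := (φ l).fst c
  map_add' x y := by rw [map_add]; rfl
  map_smul' z x := by rw [map_smul]; rfl
  cont := continuous_iff_continuousAt.2 fun l =>
    tendsto_fst_apply ((continuous_starHom φ).tendsto l) c

theorem integrable_hostLam {f : G → ℂ} (hf : Integrable f (Measure.haar (G := G))) (y : C) :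
    Integrable (fun g => f g • (hostLam hL g : 𝓜(ℂ, C)).fst y) (Measure.haar (G := G)) :=
  integrable_smul hf (continuous_hostLam_fst hL y) fun g => norm_hostLam_fst_le hL g y

/-- This identifies `ηL(f)` with `λ_f`. Both sides are bounded operators in `y`, so vectors `ηL(l)c`
suffice, and there it is the image of `ofL1_mul` under `l ↦ ηL(l)c`. -/
theorem ofL1_fst_eq_integral (f : G → ℂ) (hf : Integrable f (Measure.haar (G := G))) (y : C) :
    (ηL (ofL1 f hf)).fst y =
      ∫ g, f g • (hostLam hL g : 𝓜(ℂ, C)).fst y ∂(Measure.haar (G := G)) := by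
  rw [← smear_apply (fun g => (hostLam hL g : 𝓜(ℂ, C)).fst) (continuous_hostLam_fst hL)
    (norm_hostLam_fst_le hL) f hf]
  refine congrArg (fun T : C →L[ℂ] C => T y) (ContinuousLinearMap.ext_on hL ?_)
  rintro _ ⟨l, c, rfl⟩
  rw [smear_apply]
  have h1 : (ηL (ofL1 f hf)).fst ((ηL l).fst c) = applyCLM ηL c (ofL1 f hf * l) := by
    change _ = (ηL (ofL1 f hf * l)).fst c
    rw [map_mul]
    rfl
  rw [h1, ofL1_mul, ← ContinuousLinearMap.integral_comp_comm _
    (integrable_smul hf (continuous_groupMultiplier_fst l) fun g =>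
      norm_groupMultiplier_fst_le g l)]
  refine integral_congr_ae (Eventually.of_forall fun g => ?_)
  simp only [map_smul]
  refine congrArg (f g • ·) ?_
  exact congrArg (fun m : 𝓜(ℂ, C) => m.fst c) (hostLam_mul hL g l).symm

end Extension

namespace IsCrossedProductHost

variable {α : G →* (A ≃⋆ₐ[ℂ] A)} {ηA : A →⋆ₙₐ[ℂ] 𝓜(ℂ, C)} {ηL : GroupCStar G →⋆ₙₐ[ℂ] 𝓜(ℂ, C)}
  (h : IsCrossedProductHost α ηA ηL)

/-- The embedding of `C` in `M(C)` is injective and isometric, so the elements supplied by `mul_mem`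
depend linearly and boundedly on `l`. -/
theorem exists_prod (h : IsCrossedProductHost α ηA ηL) (a : A) : ∃ T : GroupCStar G →L[ℂ] C,
    ∀ l, ((T l : C) : 𝓜(ℂ, C)) = ηA a * ηL l := by
  choose T hT using h.mul_mem a
  refine ⟨LinearMap.mkContinuous
    { toFun := T
      map_add' := fun x y => coe_injective ?_
      map_smul' := fun c x => coe_injective ?_ } ‖ηA a‖ fun l => ?_, fun l => (hT l).symm⟩
  · change ((T (x + y) : C) : 𝓜(ℂ, C)) = DoubleCentralizer.coeHom (T x + T y)
    rw [← hT, map_add, map_add, mul_add, hT, hT]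
    rfl
  · change ((T (c • x) : C) : 𝓜(ℂ, C)) = DoubleCentralizer.coeHom (c • T x)
    rw [← hT, map_smul, map_smul, mul_smul_comm, hT]
    rfl
  · change ‖T l‖ ≤ _
    rw [← norm_coe_multiplier, ← hT]
    exact (norm_mul_le _ _).trans
      (mul_le_mul_of_nonneg_left (NonUnitalStarAlgHom.norm_apply_le ηL l) (norm_nonneg _))

/-- The element `ηA(a)ηL(l)` of `C`. -/
def prod (a : A) : GroupCStar G →L[ℂ] C := (h.exists_prod a).choose

theorem coe_prod (a : A) (l : GroupCStar G) : ((h.prod a l : C) : 𝓜(ℂ, C)) = ηA a * ηL l :=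
  (h.exists_prod a).choose_spec l

theorem eq_prod {a : A} {l : GroupCStar G} {c : C} (hc : ηA a * ηL l = (c : 𝓜(ℂ, C))) :
    c = h.prod a l :=
  coe_injective (hc.symm.trans (h.coe_prod a l).symm)

theorem prod_mul (a : A) (l : GroupCStar G) (c : C) :
    h.prod a l * c = (ηA a).fst ((ηL l).fst c) :=
  congrArg (fun m : 𝓜(ℂ, C) => m.fst c) (h.coe_prod a l)

theorem star_prod_mul (a : A) (l : GroupCStar G) (c : C) :
    star (h.prod a l) * c = (ηL (star l)).fst ((ηA (star a)).fst c) := by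
  have e : ((star (h.prod a l) : C) : 𝓜(ℂ, C)) = ηL (star l) * ηA (star a) := by
    rw [star_coe_multiplier, coe_prod, star_mul, map_star, map_star]
  exact congrArg (fun m : 𝓜(ℂ, C) => m.fst c) e

theorem generates_prod : (NonUnitalStarAlgebra.adjoin ℂ
    {c : C | ∃ (a : A) (l : GroupCStar G), c = h.prod a l}).topologicalClosure = ⊤ := by
  rw [← h.generates]
  congr 2
  ext c
  exact ⟨fun ⟨a, l, hc⟩ => ⟨a, l, by rw [hc, coe_prod]⟩, fun ⟨a, l, hc⟩ => ⟨a, l, h.eq_prod hc⟩⟩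

theorem covariance (g : G) (a : A) :
    (hostLam h.nondegenerate g : 𝓜(ℂ, C)) * ηA a =
      ηA (α g a) * (hostLam h.nondegenerate g : 𝓜(ℂ, C)) := by
  rw [← h.covariant g a, hostLam_coe, mul_assoc]
  rw [← hostLam_coe, Unitary.coe_star_mul_self, mul_one]

theorem lam_prod (g : G) (a : A) (l : GroupCStar G) :
    (hostLam h.nondegenerate g : 𝓜(ℂ, C)).fst (h.prod a l) =
      h.prod (α g a) ((groupMultiplier g).fst l) := by
  refine h.eq_prod ?_
  rw [← coe_mul_multiplier, coe_prod, ← mul_assoc, h.covariance, mul_assoc, hostLam_mul]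

/-- Nondegeneracy of `ηA`, which is not among the axioms. The closed span `N` of `ηA(A)C` is a right
ideal, and an approximate unit puts the generators into it. For their adjoints, `ηL(f)ηA(a)c = ∫
f(g) ηA(α_g(a)) λ_g c dg`, an integral of elements of `N`; its integrand equals `f(g) λ_g ηA(a)c`,
so continuity of `α` plays no role. -/
theorem dense_span_left (h : IsCrossedProductHost α ηA ηL) :
    Dense (Submodule.span ℂ {x : C | ∃ (a : A) (c : C), x = (ηA a).fst c} :
    Set C) := by
  set D := {x : C | ∃ (a : A) (c : C), x = (ηA a).fst c} with hD
  set N := (Submodule.span ℂ D).topologicalClosure with hN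
  have hNc : IsClosed (N : Set C) := Submodule.isClosed_topologicalClosure _
  have hDN : ∀ a c, (ηA a).fst c ∈ N := fun a c =>
    Submodule.le_topologicalClosure _ (Submodule.subset_span ⟨a, c, rfl⟩)
  have hideal : ∀ x ∈ N, ∀ d, x * d ∈ N := fun x hx d =>
    map_mem_closure_span ((ContinuousLinearMap.mul ℂ C).flip d) hNc (by
      rintro _ ⟨a, c, rfl⟩
      change (ηA a).fst c * d ∈ N
      rw [fst_mul_right]
      exact hDN _ _) hx
  have hL : ∀ l a c, (ηL l).fst ((ηA a).fst c) ∈ N := fun l a c => by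
    refine map_mem_closure_span (applyCLM ηL ((ηA a).fst c)) hNc ?_ (dense_span_ofL1 G l)
    rintro _ ⟨f, hf, rfl⟩
    change (ηL (ofL1 f hf)).fst ((ηA a).fst c) ∈ N
    rw [ofL1_fst_eq_integral h.nondegenerate]
    refine integral_mem_of_isClosed hNc fun g => N.smul_mem _ ?_
    have e : (hostLam h.nondegenerate g : 𝓜(ℂ, C)).fst ((ηA a).fst c) =
        (ηA (α g a)).fst ((hostLam h.nondegenerate g : 𝓜(ℂ, C)).fst c) :=
      congrArg (fun m : 𝓜(ℂ, C) => m.fst c) (h.covariance g a)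
    rw [e]
    exact hDN _ _
  let _ := CStarAlgebra.spectralOrder C
  have _ := CStarAlgebra.spectralOrderedRing C
  have hF := CStarAlgebra.increasingApproximateUnit C
  have hlim : ∀ x : C, (∀ u, x * u ∈ N) → x ∈ N := fun x hx =>
    hNc.mem_of_tendsto (hF.tendsto_mul_left x) (Eventually.of_forall hx)
  -- The adjoint is carried along because `N` is not known to be self-adjoint while the generation
  -- of `C` uses `star`.
  have main : ∀ x : C, x ∈ N ∧ star x ∈ N := by
    refine dense_adjoin_induction h.generates_prod ?_ ?_ (by simp) ?_ ?_ ?_ ?_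
    · exact hNc.inter (hNc.preimage continuous_star)
    · rintro _ ⟨a, l, rfl⟩
      refine ⟨hlim _ fun u => ?_, hlim _ fun u => ?_⟩
      · rw [prod_mul]; exact hDN _ _
      · rw [star_prod_mul]; exact hL _ _ _
    · intro x y hx hy
      rw [star_add]
      exact ⟨add_mem hx.1 hy.1, add_mem hx.2 hy.2⟩
    · intro x y hx hy
      rw [star_mul]
      exact ⟨hideal _ hx.1 _, hideal _ hy.2 _⟩
    · intro c x hx
      rw [star_smul]
      exact ⟨N.smul_mem _ hx.1, N.smul_mem _ hx.2⟩
    · intro x hx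
      rw [star_star]
      exact ⟨hx.2, hx.1⟩
  exact fun x => (main x).1

/-- A total set without adjoints, on which left multiplication by `λ_g` and `ηA(a)` affects only the
first factor. -/
theorem dense_span_prod_mul : Dense (Submodule.span ℂ
    {x : C | ∃ (a : A) (l : GroupCStar G) (c : C), x = h.prod a l * c} : Set C) := by
  refine dense_span_of_dense h.dense_span_left ?_
  rintro _ ⟨a, c, rfl⟩
  refine map_mem_closure_span (ηA a).fst (Submodule.isClosed_topologicalClosure _) ?_
    (h.nondegenerate c)
  rintro _ ⟨l, d, rfl⟩
  exact Submodule.le_topologicalClosure _ (Submodule.subset_span ⟨a, l, d, (h.prod_mul a l d).symm⟩)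

theorem hom_ext {φ ψ : C →⋆ₙₐ[ℂ] C} (hφ : ∀ (a : A) (f : G → ℂ)
    (hf : Integrable f (Measure.haar (G := G))),
      φ (h.prod a (ofL1 f hf)) = ψ (h.prod a (ofL1 f hf))) (c : C) : φ c = ψ c := by
  refine dense_adjoin_induction h.generates_prod (p := fun c => φ c = ψ c)
    (isClosed_eq (continuous_starHom φ) (continuous_starHom ψ)) ?_ (by simp) ?_ ?_ ?_ ?_ c
  · rintro _ ⟨a, l, rfl⟩
    let T : (C →⋆ₙₐ[ℂ] C) → (GroupCStar G →L[ℂ] C) := fun χ =>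
      (⟨(χ : C →ₗ[ℂ] C), continuous_starHom χ⟩ : C →L[ℂ] C).comp (h.prod a)
    refine congrArg (fun S : GroupCStar G →L[ℂ] C => S l)
      (ContinuousLinearMap.ext_on (f := T φ) (g := T ψ) (dense_span_ofL1 G) ?_)
    rintro _ ⟨f, hf, rfl⟩
    exact hφ a f hf
  · intro x y hx hy; rw [map_add, map_add, hx, hy]
  · intro x y hx hy; rw [map_mul, map_mul, hx, hy]
  · intro c x hx; rw [map_smul, map_smul, hx]
  · intro x hx; rw [map_star, map_star, hx]

end IsCrossedProductHost

end HostLemmas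

/-! ### The dual action and the canonical `G`-product structure -/

section DualAction

theorem IsCovariant.twist {G A : Type u} [CommGroup G] [TopologicalSpace G]
    [NonUnitalCStarAlgebra A] {α : G →* (A ≃⋆ₐ[ℂ] A)} {U : UnitaryRep G}
    {π : A →⋆ₙₐ[ℂ] (U.space →L[ℂ] U.space)}
    (hU : IsCovariant α U π) (τ : PontryaginDual G) : IsCovariant α (U.twist τ) π := by
  refine ⟨hU.1, fun g a => ?_⟩
  refine Eq.trans ?_ (hU.2 g a)
  have e := UnitaryRep.twist_toHom τ U g
  have h1 : ((((τ g : Circle) : ℂ) • (U.toHom g : U.space →L[ℂ] U.space)) * π a *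
      star (((τ g : Circle) : ℂ) • (U.toHom g : U.space →L[ℂ] U.space))) =
      (U.toHom g : U.space →L[ℂ] U.space) * π a *
        star (U.toHom g : U.space →L[ℂ] U.space) := by
    have hz : star ((τ g : Circle) : ℂ) * ((τ g : Circle) : ℂ) = 1 := by
      rw [Complex.star_def, ← Complex.normSq_eq_conj_mul_self, Circle.normSq_coe,
        Complex.ofReal_one]
    rw [star_smul, mul_smul_comm, smul_mul_assoc, smul_mul_assoc, smul_smul, hz, one_smul]
  exact (congrArg (fun T : U.space →L[ℂ] U.space => T * π a * star T) e).trans h1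

variable {G A C : Type u} [CommGroup G] [TopologicalSpace G] [IsTopologicalGroup G] [T2Space G]
  [LocallyCompactSpace G] [MeasurableSpace G] [BorelSpace G]
  [NonUnitalCStarAlgebra A] [NonUnitalCStarAlgebra C]
  {α : G →* (A ≃⋆ₐ[ℂ] A)} {ηA : A →⋆ₙₐ[ℂ] 𝓜(ℂ, C)} {ηL : GroupCStar G →⋆ₙₐ[ℂ] 𝓜(ℂ, C)}

section Rep

variable {H : Type u} [NormedAddCommGroup H] [InnerProductSpace ℂ H] [CompleteSpace H]

/-- The unitary representation `g ↦ ψ(λ_g)` for the extension `ψ` to `M(C)` of a nondegenerate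
representation of `C`. -/
def hostRep (hL : IsNondegenerate ηL) {ρ : C →⋆ₙₐ[ℂ] (H →L[ℂ] H)} (hρ : IsNondegenerateRep ρ)
    (ψ : 𝓜(ℂ, C) →⋆ₐ[ℂ] (H →L[ℂ] H)) (hψ : ∀ m c, ψ m * ρ c = ρ (m.fst c)) : UnitaryRep G where
  space := H
  toHom := (unitaryHom ψ).comp (hostLam hL)
  continuous_apply := by
    refine continuous_apply_of_dense
      (fun g => ((ψ (hostLam hL g : 𝓜(ℂ, C)) : H →L[ℂ] H) : H →ₗ[ℂ] H)) (fun g v => ?_) hρ ?_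
    · simpa using (ψ (hostLam hL g : 𝓜(ℂ, C))).le_of_opNorm_le
        (norm_unitary_le (unitaryHom ψ (hostLam hL g))) v
    · rintro _ ⟨c, v, rfl⟩
      have h : ∀ g, ψ (hostLam hL g : 𝓜(ℂ, C)) (ρ c v) =
          ρ ((hostLam hL g : 𝓜(ℂ, C)).fst c) v := fun g =>
        congrArg (fun T : H →L[ℂ] H => T v) (hψ _ c)
      simp only [ContinuousLinearMap.coe_coe, h]
      exact (ContinuousLinearMap.apply ℂ H v).continuous.comp
        ((continuous_starHom ρ).comp (continuous_hostLam_fst hL c))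

/-- For `f ∈ L¹(G)` this is the image under `ρ` of the integral formula for `ηL(f)c`; density of
`L¹(G)` gives the rest. -/
theorem integratedRep_hostRep (hL : IsNondegenerate ηL) {ρ : C →⋆ₙₐ[ℂ] (H →L[ℂ] H)}
    (hρ : IsNondegenerateRep ρ) (ψ : 𝓜(ℂ, C) →⋆ₐ[ℂ] (H →L[ℂ] H))
    (hψ : ∀ m c, ψ m * ρ c = ρ (m.fst c)) (l : GroupCStar G) :
    (hostRep hL hρ ψ hψ).integratedRep l = ψ (ηL l) := by
  refine GroupCStar.hom_ext (φ := (hostRep hL hρ ψ hψ).integratedRep)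
    (ψ := (ψ : 𝓜(ℂ, C) →⋆ₙₐ[ℂ] (H →L[ℂ] H)).comp ηL) (fun f hf => ?_) l
  change (hostRep hL hρ ψ hψ).integrated f hf = ψ (ηL (ofL1 f hf))
  refine ext_of_nondegenerateRep hρ fun c => ?_
  rw [hψ, ofL1_fst_eq_integral hL]
  refine ContinuousLinearMap.ext fun v => ?_
  let Φ : C →L[ℂ] H := (ContinuousLinearMap.apply ℂ H v).comp
    ⟨(ρ : C →ₗ[ℂ] (H →L[ℂ] H)), continuous_starHom ρ⟩
  change (hostRep hL hρ ψ hψ).integrated f hf (ρ c v) = Φ _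
  rw [← Φ.integral_comp_comm (integrable_hostLam hL hf c)]
  change ∫ g, f g • ψ (hostLam hL g : 𝓜(ℂ, C)) (ρ c v) ∂(Measure.haar (G := G)) = _
  refine integral_congr_ae (Eventually.of_forall fun g => ?_)
  simp only [map_smul]
  exact congrArg (fun T : H →L[ℂ] H => f g • T v) (hψ _ c)

theorem isCovariant_hostRep (h : IsCrossedProductHost α ηA ηL) {ρ : C →⋆ₙₐ[ℂ] (H →L[ℂ] H)}
    (hρ : IsNondegenerateRep ρ) (ψ : 𝓜(ℂ, C) →⋆ₐ[ℂ] (H →L[ℂ] H))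
    (hψ : ∀ m c, ψ m * ρ c = ρ (m.fst c)) :
    IsCovariant α (hostRep h.nondegenerate hρ ψ hψ)
      ((ψ : 𝓜(ℂ, C) →⋆ₙₐ[ℂ] (H →L[ℂ] H)).comp ηA) := by
  constructor
  · change Dense (Submodule.span ℂ {w : H | ∃ (a : A) (v : H), w = ψ (ηA a) v} : Set H)
    refine dense_span_of_dense hρ ?_
    rintro _ ⟨c, v, rfl⟩
    let Φ : C →L[ℂ] H := (ContinuousLinearMap.apply ℂ H v).comp
      ⟨(ρ : C →ₗ[ℂ] (H →L[ℂ] H)), continuous_starHom ρ⟩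
    refine map_mem_closure_span Φ (Submodule.isClosed_topologicalClosure _) ?_
      (h.dense_span_left c)
    rintro _ ⟨a, d, rfl⟩
    exact Submodule.le_topologicalClosure _ (Submodule.subset_span ⟨a, ρ d v,
      congrArg (fun T : H →L[ℂ] H => T v) (hψ (ηA a) d).symm⟩)
  · intro g a
    have e : ψ (hostLam h.nondegenerate g : 𝓜(ℂ, C)) * ψ (ηA a) *
        star (ψ (hostLam h.nondegenerate g : 𝓜(ℂ, C))) = ψ (ηA (α g a)) := by
      rw [← map_star, ← map_mul, ← map_mul, hostLam_coe, h.covariant]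
    exact e

end Rep

namespace IsFullCrossedProductHost

/-- Fullness enters here: for each nondegenerate `ρ`, the required companion `ρ'` is the
representation attached to the `τ`-twist of the covariant pair of `ρ`. -/
theorem exists_dualHom (h : IsFullCrossedProductHost α ηA ηL) (τ : PontryaginDual G) :
    ∃ δ : C →⋆ₙₐ[ℂ] C, ∀ (a : A) (l : GroupCStar G),
      δ (h.prod a l) = h.prod a (GroupCStar.twist τ l) := by
  obtain ⟨δ, hδ⟩ := exists_starHom_of_generators
    {p : C × C | ∃ (a : A) (l : GroupCStar G), p = (h.prod a l, h.prod a (GroupCStar.twist τ l))}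
    (by
      rw [← h.generates_prod]
      congr 2
      ext c
      constructor
      · rintro ⟨_, ⟨a, l, rfl⟩, rfl⟩; exact ⟨a, l, rfl⟩
      · rintro ⟨a, l, rfl⟩; exact ⟨_, ⟨a, l, rfl⟩, rfl⟩)
    (by
      intro H _ _ _ ρ hρ
      obtain ⟨ψ, hψ⟩ := exists_repExtension hρ
      have hcov := (isCovariant_hostRep h.toIsCrossedProductHost hρ ψ hψ).twist τ
      obtain ⟨ρ', hρ', -⟩ := h.full _ _ hcov
      refine ⟨ρ', ?_⟩
      rintro _ ⟨a, l, rfl⟩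
      refine (hρ' a l _ (h.coe_prod a l).symm).trans ?_
      have e := integratedRep_hostRep h.nondegenerate hρ ψ hψ (GroupCStar.twist τ l)
      refine (congrArg (fun T : H →L[ℂ] H => ψ (ηA a) * T) e).trans ?_
      refine ext_of_nondegenerateRep hρ fun c => ?_
      rw [← map_mul ψ, hψ, ← map_mul ρ, h.prod_mul]
      rfl)
  exact ⟨δ, fun a l => hδ _ ⟨a, l, rfl⟩⟩

variable (h : IsFullCrossedProductHost α ηA ηL)

/-- The endomorphism of `C` that carries `ηA(a)ηL(f)` into `ηA(a)ηL(τf)`. -/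
def dualHom (τ : PontryaginDual G) : C →⋆ₙₐ[ℂ] C := (h.exists_dualHom τ).choose

theorem dualHom_prod (τ : PontryaginDual G) (a : A) (l : GroupCStar G) :
    h.dualHom τ (h.prod a l) = h.prod a (GroupCStar.twist τ l) :=
  (h.exists_dualHom τ).choose_spec a l

theorem dualHom_mul (τ σ : PontryaginDual G) (c : C) :
    h.dualHom (τ * σ) c = h.dualHom τ (h.dualHom σ c) :=
  h.hom_ext (ψ := (h.dualHom τ).comp (h.dualHom σ)) (fun a f hf => by
    rw [NonUnitalStarAlgHom.comp_apply, dualHom_prod, dualHom_prod, dualHom_prod, twist_mul]) c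

theorem dualHom_one (c : C) : h.dualHom 1 c = c :=
  h.hom_ext (ψ := NonUnitalStarAlgHom.id ℂ C) (fun a f hf => by
    rw [dualHom_prod, twist_one]; rfl) c

/-- The dual action on `C`. -/
def dualAction : PontryaginDual G →* (C ≃⋆ₐ[ℂ] C) where
  toFun τ :=
    { toFun := h.dualHom τ
      invFun := h.dualHom τ⁻¹
      left_inv := fun c => by rw [← dualHom_mul, inv_mul_cancel, dualHom_one]
      right_inv := fun c => by rw [← dualHom_mul, mul_inv_cancel, dualHom_one]
      map_mul' := map_mul _
      map_add' := map_add _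
      map_star' := map_star _
      map_smul' := map_smul _ }
  map_one' := StarAlgEquiv.ext fun c => h.dualHom_one c
  map_mul' τ σ := StarAlgEquiv.ext fun c => h.dualHom_mul τ σ c

theorem continuous_dualHom (c : C) : Continuous fun τ => h.dualHom τ c := by
  set s := {c : C | ∃ (a : A) (l : GroupCStar G), c = h.prod a l} with hs
  -- Products of the `ηA(a)ηL(l)` and their adjoints are needed for density, so the total set is the
  -- whole generated algebra; continuity passes through its operations.
  have hd : Dense (Submodule.span ℂ (NonUnitalStarAlgebra.adjoin ℂ s : Set C) : Set C) := by
    have h1 : Dense (NonUnitalStarAlgebra.adjoin ℂ s : Set C) := fun x => by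
      have hx : x ∈ (NonUnitalStarAlgebra.adjoin ℂ s).topologicalClosure :=
        h.generates_prod ▸ trivial
      exact hx
    exact h1.mono Submodule.subset_span
  refine continuous_apply_of_dense (fun τ => (h.dualHom τ : C →ₗ[ℂ] C))
    (fun τ => NonUnitalStarAlgHom.norm_apply_le (h.dualHom τ)) hd (fun d hd => ?_) c
  change Continuous fun τ => h.dualHom τ d
  induction hd using NonUnitalStarAlgebra.adjoin_induction with
  | mem x hx =>
    obtain ⟨a, l, rfl⟩ := hx
    simp only [dualHom_prod]
    exact (h.prod a).continuous.comp (continuous_twist l)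
  | add x y _ _ hx hy => simp only [map_add]; exact hx.add hy
  | zero => simp only [map_zero]; exact continuous_const
  | mul x y _ _ hx hy => simp only [map_mul]; exact hx.mul hy
  | smul r x _ hx => simp only [map_smul]; exact hx.const_smul r
  | star x _ hx => simp only [map_star]; exact hx.star

/-- The canonical `G`-product structure of a full crossed product host. -/
def canonicalGProduct : GProduct G C where
  lam := hostLam h.nondegenerate
  continuous_lam := continuous_hostLam_fst h.nondegenerate
  dual := h.dualAction
  continuous_dual := h.continuous_dualHom
  dual_lam g τ := by
    refine extendAut_eq fun y => ?_
    let D : C →L[ℂ] C := ⟨(h.dualHom τ : C →ₗ[ℂ] C), continuous_starHom (h.dualHom τ)⟩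
    -- On `ηA(a)ηL(l)c`, `λ_g` turns `a` into `α_g(a)` and translates `l`; twisting the translated
    -- `l` produces the factor `⟨g, τ⟩`.
    refine congrArg (fun T : C →L[ℂ] C => T y) (ContinuousLinearMap.ext_on
      (f := D.comp (hostLam h.nondegenerate g : 𝓜(ℂ, C)).fst)
      (g := (((τ g : Circle) : ℂ) • (hostLam h.nondegenerate g : 𝓜(ℂ, C))).fst.comp D)
      h.dense_span_prod_mul ?_)
    rintro _ ⟨a, l, c, rfl⟩
    change h.dualHom τ ((hostLam h.nondegenerate g : 𝓜(ℂ, C)).fst (h.prod a l * c)) =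
      ((τ g : Circle) : ℂ) • (hostLam h.nondegenerate g : 𝓜(ℂ, C)).fst
        (h.dualHom τ (h.prod a l * c))
    rw [← fst_mul_right, h.lam_prod, map_mul, map_mul, h.dualHom_prod, h.dualHom_prod,
      ← fst_mul_right, h.lam_prod, twist_groupMultiplier_fst, map_smul, smul_mul_assoc]

theorem isCanonicalGProduct_canonicalGProduct :
    IsCanonicalGProduct h.toIsCrossedProductHost h.canonicalGProduct where
  lam_eq _ := rfl
  dual_eq τ a f hf c hc := by
    change ((h.dualHom τ c : C) : 𝓜(ℂ, C)) = _
    rw [h.eq_prod hc, h.dualHom_prod, h.coe_prod, twist_ofL1]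

end IsFullCrossedProductHost

namespace IsCanonicalGProduct

variable {P : GProduct G C}

theorem lam_eq_hostLam {h : IsCrossedProductHost α ηA ηL} (hP : IsCanonicalGProduct h P) :
    P.lam = hostLam h.nondegenerate :=
  MonoidHom.ext fun g => Subtype.ext (hP.lam_eq g)

theorem dual_eq_dualAction (h : IsFullCrossedProductHost α ηA ηL)
    (hP : IsCanonicalGProduct h.toIsCrossedProductHost P) :
    P.dual = h.dualAction := by
  refine MonoidHom.ext fun τ => StarAlgEquiv.ext fun c => ?_
  refine h.hom_ext (φ := (P.dual τ : C →⋆ₙₐ[ℂ] C)) (ψ := h.dualHom τ) (fun a f hf => ?_) c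
  refine coe_injective ?_
  change ((P.dual τ (h.prod a (ofL1 f hf)) : C) : 𝓜(ℂ, C)) = (h.dualHom τ _ : C)
  rw [hP.dual_eq τ a f hf _ (h.coe_prod a _).symm, h.dualHom_prod, h.coe_prod, twist_ofL1]

theorem eq_canonicalGProduct (h : IsFullCrossedProductHost α ηA ηL)
    (hP : IsCanonicalGProduct h.toIsCrossedProductHost P) :
    P = h.canonicalGProduct := by
  have h1 := hP.lam_eq_hostLam
  have h2 := hP.dual_eq_dualAction h
  cases P
  cases h1
  cases h2
  rfl

end IsCanonicalGProduct

end DualAction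

/-! ### The Landstad conditions -/

section LandstadLemmas

theorem GProduct.landstadAlgebra_subset {G B : Type*} [CommGroup G] [TopologicalSpace G]
    [NonUnitalCStarAlgebra B] [IsTopologicalGroup G] [T2Space G] [LocallyCompactSpace G]
    [MeasurableSpace G] [BorelSpace G] (P : GProduct G B) :
    P.landstadAlgebra ⊆ P.weakLandstadAlgebra := fun _ ⟨h1, h2, h3⟩ =>
  ⟨h1, h2, fun b =>
    ⟨continuous_iff_continuousAt.2 fun g => tendsto_fst_apply (h3.tendsto g) b,
      continuous_iff_continuousAt.2 fun g => tendsto_snd_apply (h3.tendsto g) b⟩⟩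

/-- Split `T_x F(x) = T_x(F(x) - F(x₀)) + T_x F(x₀)`. This handles the two-sided factors of the
orbit map. -/
theorem continuous_apply_of_contractive {X E : Type*} [TopologicalSpace X] [NormedAddCommGroup E]
    [NormedSpace ℂ E] {T : X → E →L[ℂ] E} (hT : ∀ x v, ‖T x v‖ ≤ ‖v‖)
    (hc : ∀ v, Continuous fun x => T x v) {F : X → E} (hF : Continuous F) :
    Continuous fun x => T x (F x) := by
  refine continuous_iff_continuousAt.2 fun x₀ => ?_
  have h1 : Tendsto (fun x => T x (F x - F x₀)) (𝓝 x₀) (𝓝 0) :=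
    squeeze_zero_norm (fun x => hT x _) (tendsto_iff_norm_sub_tendsto_zero.1 (hF.tendsto x₀))
  have h2 := h1.add ((hc (F x₀)).tendsto x₀)
  simpa only [map_sub, sub_add_cancel, zero_add, ContinuousAt] using h2

variable {G A C : Type u} [CommGroup G] [TopologicalSpace G] [IsTopologicalGroup G] [T2Space G]
  [LocallyCompactSpace G] [MeasurableSpace G] [BorelSpace G]
  [NonUnitalCStarAlgebra A] [NonUnitalCStarAlgebra C]
  {α : G →* (A ≃⋆ₐ[ℂ] A)} {ηA : A →⋆ₙₐ[ℂ] 𝓜(ℂ, C)} {ηL : GroupCStar G →⋆ₙₐ[ℂ] 𝓜(ℂ, C)}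

theorem IsFullCrossedProductHost.mem_weakLandstadAlgebra
    (h : IsFullCrossedProductHost α ηA ηL) (a : A) :
    ηA a ∈ h.canonicalGProduct.weakLandstadAlgebra := by
  set P := h.canonicalGProduct
  have hlam : ∀ f hf, P.lamL1 f hf = ηL (ofL1 f hf) := fun f hf =>
    multiplier_ext fun y => (ofL1_fst_eq_integral h.nondegenerate f hf y).symm
  -- The host puts only products with `ηA` on the left into `C`; the other order is `λ_f ηA(a) =
  -- (ηA(a*) λ_f*)*`.
  refine ⟨fun τ => extendAut_eq fun y => ?_, fun f hf => ⟨⟨h.prod a (ofL1 f hf), ?_⟩,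
    ⟨star (h.prod (star a) (star (ofL1 f hf))), ?_⟩⟩, fun b => ⟨?_, ?_⟩⟩
  · let D : C →L[ℂ] C := ⟨(h.dualHom τ : C →ₗ[ℂ] C), continuous_starHom (h.dualHom τ)⟩
    refine congrArg (fun T : C →L[ℂ] C => T y) (ContinuousLinearMap.ext_on
      (f := D.comp (ηA a).fst) (g := (ηA a).fst.comp D) h.dense_span_prod_mul ?_)
    rintro _ ⟨b, l, c, rfl⟩
    have e : ∀ l, (ηA a).fst (h.prod b l) = h.prod (a * b) l := fun l =>
      h.eq_prod (by rw [← coe_mul_multiplier, h.coe_prod, map_mul, mul_assoc])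
    change h.dualHom τ ((ηA a).fst (h.prod b l * c)) = (ηA a).fst (h.dualHom τ (h.prod b l * c))
    rw [← fst_mul_right, e, map_mul, map_mul, h.dualHom_prod, h.dualHom_prod, ← fst_mul_right, e]
  · rw [hlam, h.coe_prod]
  · rw [hlam, star_coe_multiplier, h.coe_prod, star_mul, map_star, map_star, star_star, star_star]
  · exact continuous_apply_of_contractive P.norm_lam_fst_le P.continuous_lam
      ((ηA a).fst.continuous.comp ((P.continuous_lam b).comp continuous_inv))
  -- Right multiplication composes in the opposite order: `λ_g` acts on `b` first and `λ_{g⁻¹}`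
  -- last.
  · exact continuous_apply_of_contractive (fun g => P.norm_lam_snd_le g⁻¹)
      (fun v => (P.continuous_lam_snd v).comp continuous_inv)
      ((ηA a).snd.continuous.comp (P.continuous_lam_snd b))

end LandstadLemmas

end CPHost

end

theorem mainTheorem10 {G A C : Type u}
    [CommGroup G] [TopologicalSpace G] [IsTopologicalGroup G] [T2Space G] [LocallyCompactSpace G]
    [MeasurableSpace G] [BorelSpace G]
    [NonUnitalCStarAlgebra A] [NonUnitalCStarAlgebra C]
    (α : G →* (A ≃⋆ₐ[ℂ] A)) (ηA : A →⋆ₙₐ[ℂ] 𝓜(ℂ, C))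
    (ηL : CPHost.GroupCStar G →⋆ₙₐ[ℂ] 𝓜(ℂ, C))
    (h : CPHost.IsFullCrossedProductHost α ηA ηL) :
    (∃! P : CPHost.GProduct G C, CPHost.IsCanonicalGProduct h.toIsCrossedProductHost P) ∧
    ∀ P : CPHost.GProduct G C, CPHost.IsCanonicalGProduct h.toIsCrossedProductHost P →
      P.landstadAlgebra ⊆ P.weakLandstadAlgebra ∧
      Set.range ηA ⊆ P.weakLandstadAlgebra := by
  have hP := h.isCanonicalGProduct_canonicalGProduct
  refine ⟨⟨h.canonicalGProduct, hP, fun P hP' => hP'.eq_canonicalGProduct h⟩, fun P hP' => ?_⟩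
  rw [hP'.eq_canonicalGProduct h]
  refine ⟨CPHost.GProduct.landstadAlgebra_subset _, ?_⟩
  rintro _ ⟨a, rfl⟩
  exact h.mem_weakLandstadAlgebra a
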